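/- Let $G$ and $H$ be second countable locally compact Hausdorff groupoids with Haar systems $\{\lambda^u\}_{u\in G^0}$ and $\{\beta^v\}_{v\in H^0}$, and let $Z$ be a second countable locally compact Hausdorff space that is a $(G,H)$-equivalence: $Z$ is a free and proper left $G$-space and a free and proper right $H$-space (with continuous open structure maps $r:Z\to G^0$ and $s:Z\to H^0$), the two actions commute, and $r$ and $s$ induce homeomorphisms $Z/H\to G^0$ and $G\backslash Z\to H^0$. Let $Z^{op}=\{\bar z: z\in Z\}$ be the opposite $(H,G)$-equivalence, a homeomorphic copy of $Z$ with $r(\bar z)=s(z)$, $s(\bar z)=r(z)$, $\eta\cdot\bar z=\overline{z\cdot\eta^{-1}}$ and $\bar z\cdot\gamma=\overline{\gamma^{-1}\cdot z}$. Let $L=G\sqcup Z\sqcup Z^{op}\sqcup H$ be the topological disjoint union, with $L^0=G^0\sqcup H^0$, with the range and source maps of the four pieces, with the product given by the products of $G$ and $H$, by their actions on $Z$ and $Z^{op}$, and by $z\bar y={}_G[z,y]$ if $s(z)=s(y)$ and $\bar y z=[y,z]_H$ if $r(y)=r(z)$, where ${}_G[z,y]\cdot y=z$ and $y\cdot[y,z]_H=z$,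 and with the inverse given by the inversions of $G$ and $H$ and by $z^{-1}=\bar z$, $\bar z^{-1}=z$. Then: (a) $L$ is a second countable locally compact Hausdorff groupoid (the linking groupoid of $Z$). (b) For each $u\in G^0$ there is a unique Radon measure $\sigma_Z^u$ on $Z$ such that $\sigma_Z^u(\phi)=\int_H\phi(z\cdot\eta)\,d\beta^{s(z)}(\eta)$ for all $\phi\in C_c(Z)$ and all $z\in Z$ with $r(z)=u$. Likewise for each $v\in H^0$ there is a unique Radon measure $\sigma_{Z^{op}}^v$ on $Z^{op}$ such that $\sigma_{Z^{op}}^v(\psi)=\int_G\psi(\bar z\cdot\gamma)\,d\lambda^{r(z)}(\gamma)$ for all $\psi\in C_c(Z^{op})$ and all $z\in Z$ with $s(z)=v$. (c) For each $w\in L^0$ there is a unique Radon measure $\kappa^w$ on $L$ given on $F\in C_c(L)$ by $$\kappa^w(F)=\begin{cases}\lambda^w(F|_G)+\sigma_Z^w(F|_Z)&\text{if }w\in G^0,\\ \sigma_{Z^{op}}^w(F|_{Z^{op}})+\beta^w(F|_H)&\text{if }w\in H^0,\end{cases}$$ and $\{\kappa^w\}_{w\in L^0}$ is a Haar system for $L$: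 the support of $\kappa^w$ is $r^{-1}(w)$, the function $w\mapsto\kappa^w(F)$ is continuous for every $F\in C_c(L)$, and $\int_L F(kl)\,d\kappa^{s(k)}(l)=\int_L F(l)\,d\kappa^{r(k)}(l)$ for all $F\in C_c(L)$ and $k\in L$. -/

import Mathlib

open MeasureTheory Topology
open scoped CompactlySupported

noncomputable section

namespace GroupoidEquiv

universe u₁ u₂ u₃ u₄ u₅

/-! ### Topological groupoids

A groupoid is given by its space of elements `G` and its unit space `G₀`; `unit` identifies `G₀`
with a subset of `G`.  The product is written as a total function, but only its values `mul x y`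
on composable pairs (`s x = r y`) are meaningful: all axioms are restricted to those pairs. -/

/-- The operations of a groupoid with unit space `G₀` and set of elements `G`. -/
structure GroupoidStr (G₀ : Type u₁) (G : Type u₂) where
  r : G → G₀
  s : G → G₀
  unit : G₀ → G
  mul : G → G → G
  inv : G → G

/-- The algebraic axioms of a groupoid. -/
structure GroupoidStr.IsGroupoid {G₀ : Type u₁} {G : Type u₂} (𝒢 : GroupoidStr G₀ G) :
    Prop where
  r_unit : ∀ u, 𝒢.r (𝒢.unit u) = u
  s_unit : ∀ u, 𝒢.s (𝒢.unit u) = u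
  r_mul : ∀ x y, 𝒢.s x = 𝒢.r y → 𝒢.r (𝒢.mul x y) = 𝒢.r x
  s_mul : ∀ x y, 𝒢.s x = 𝒢.r y → 𝒢.s (𝒢.mul x y) = 𝒢.s y
  mul_assoc : ∀ x y z, 𝒢.s x = 𝒢.r y → 𝒢.s y = 𝒢.r z →
    𝒢.mul (𝒢.mul x y) z = 𝒢.mul x (𝒢.mul y z)
  unit_mul : ∀ x, 𝒢.mul (𝒢.unit (𝒢.r x)) x = x
  mul_unit : ∀ x, 𝒢.mul x (𝒢.unit (𝒢.s x)) = x
  r_inv : ∀ x, 𝒢.r (𝒢.inv x) = 𝒢.s x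
  s_inv : ∀ x, 𝒢.s (𝒢.inv x) = 𝒢.r x
  mul_inv : ∀ x, 𝒢.mul x (𝒢.inv x) = 𝒢.unit (𝒢.r x)
  inv_mul : ∀ x, 𝒢.mul (𝒢.inv x) x = 𝒢.unit (𝒢.s x)

/-- Second countable, locally compact Hausdorff topological groupoids.  As `unit` is continuous
with continuous left inverse `r`, the topology of `G₀` is the one that it has as a
subspace of `G`. -/
structure GroupoidStr.IsLocallyCompactGroupoid {G₀ : Type u₁} {G : Type u₂}
    [TopologicalSpace G₀] [TopologicalSpace G] (𝒢 : GroupoidStr G₀ G) : Prop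
    extends 𝒢.IsGroupoid where
  t2 : T2Space G
  locallyCompact : LocallyCompactSpace G
  secondCountable : SecondCountableTopology G
  continuous_r : Continuous 𝒢.r
  continuous_s : Continuous 𝒢.s
  continuous_unit : Continuous 𝒢.unit
  continuous_inv : Continuous 𝒢.inv
  continuousOn_mul : ContinuousOn (fun p : G × G => 𝒢.mul p.1 p.2) {p | 𝒢.s p.1 = 𝒢.r p.2}

/-- A (left) Haar system on a groupoid: a family of Radon measures `lam u` on `G`, indexed by the
unit space, such that the support of `lam u` is `G^u = r⁻¹(u)`, `u ↦ ∫ f d(lam u)` is continuous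
for `f ∈ C_c(G)`, and `∫ f(xy) d(lam (s x))(y) = ∫ f(y) d(lam (r x))(y)`. -/
structure GroupoidStr.IsHaarSystem {G₀ : Type u₁} {G : Type u₂}
    [TopologicalSpace G₀] [TopologicalSpace G] [MeasurableSpace G]
    (𝒢 : GroupoidStr G₀ G) (lam : G₀ → Measure G) : Prop where
  regular : ∀ u, (lam u).Regular
  support_eq : ∀ u, (lam u).support = {x | 𝒢.r x = u}
  continuous_integral : ∀ f : C_c(G, ℂ), Continuous (fun u => ∫ x, f x ∂(lam u))
  left_invariant : ∀ (f : C_c(G, ℂ)) (x : G),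
    ∫ y, f (𝒢.mul x y) ∂(lam (𝒢.s x)) = ∫ y, f y ∂(lam (𝒢.r x))

/-! ### Equivalences of groupoids -/

/-- The structure maps `r : Z → G₀`, `s : Z → H₀` and the operations `γ • z`, `z • η` of a space
with a left `G`-action and a right `H`-action.  The actions are written as total functions, but
only `lact γ z` with `s γ = r z` and `ract z η` with `s z = r η` are meaningful. -/
structure BiactionStr (G₀ : Type u₁) (G : Type u₂) (H₀ : Type u₃) (H : Type u₄) (Z : Type u₅)
    where
  r : Z → G₀
  s : Z → H₀
  lact : G → Z → Z
  ract : Z → H → Z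

section Equivalence

variable {G₀ : Type u₁} {G : Type u₂} {H₀ : Type u₃} {H : Type u₄} {Z : Type u₅}

/-- `Z` is a free and proper left `G`-space. -/
structure IsFreeProperLeftSpace [TopologicalSpace G₀] [TopologicalSpace G] [TopologicalSpace Z]
    (𝒢 : GroupoidStr G₀ G) (E : BiactionStr G₀ G H₀ H Z) : Prop where
  continuous_r : Continuous E.r
  isOpenMap_r : IsOpenMap E.r
  continuousOn_lact :
    ContinuousOn (fun p : G × Z => E.lact p.1 p.2) {p | 𝒢.s p.1 = E.r p.2}
  r_lact : ∀ γ z, 𝒢.s γ = E.r z → E.r (E.lact γ z) = 𝒢.r γ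
  unit_lact : ∀ z, E.lact (𝒢.unit (E.r z)) z = z
  mul_lact : ∀ γ η z, 𝒢.s γ = 𝒢.r η → 𝒢.s η = E.r z →
    E.lact (𝒢.mul γ η) z = E.lact γ (E.lact η z)
  free : ∀ γ z, 𝒢.s γ = E.r z → E.lact γ z = z → γ = 𝒢.unit (E.r z)
  proper : IsProperMap
    (fun p : {p : G × Z // 𝒢.s p.1 = E.r p.2} => (E.lact p.1.1 p.1.2, p.1.2))

/-- `Z` is a free and proper right `H`-space. -/
structure IsFreeProperRightSpace [TopologicalSpace H₀] [TopologicalSpace H] [TopologicalSpace Z]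
    (ℋ : GroupoidStr H₀ H) (E : BiactionStr G₀ G H₀ H Z) : Prop where
  continuous_s : Continuous E.s
  isOpenMap_s : IsOpenMap E.s
  continuousOn_ract :
    ContinuousOn (fun p : Z × H => E.ract p.1 p.2) {p | E.s p.1 = ℋ.r p.2}
  s_ract : ∀ z η, E.s z = ℋ.r η → E.s (E.ract z η) = ℋ.s η
  ract_unit : ∀ z, E.ract z (ℋ.unit (E.s z)) = z
  ract_mul : ∀ z η ζ, E.s z = ℋ.r η → ℋ.s η = ℋ.r ζ →
    E.ract z (ℋ.mul η ζ) = E.ract (E.ract z η) ζ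
  free : ∀ z η, E.s z = ℋ.r η → E.ract z η = z → η = ℋ.unit (E.s z)
  proper : IsProperMap
    (fun p : {p : Z × H // E.s p.1 = ℋ.r p.2} => (E.ract p.1.1 p.1.2, p.1.1))

/-- `w` lies in the `G`-orbit of `z`. -/
def LeftOrbitRel (𝒢 : GroupoidStr G₀ G) (E : BiactionStr G₀ G H₀ H Z) (z w : Z) : Prop :=
  ∃ γ, 𝒢.s γ = E.r z ∧ E.lact γ z = w

/-- `w` lies in the `H`-orbit of `z`. -/
def RightOrbitRel (ℋ : GroupoidStr H₀ H) (E : BiactionStr G₀ G H₀ H Z) (z w : Z) : Prop :=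
  ∃ η, E.s z = ℋ.r η ∧ E.ract z η = w

/-- The (second countable, locally compact Hausdorff) space `Z` is a `(G, H)`-equivalence.
`Quot (RightOrbitRel ℋ E)` is the orbit space `Z/H` and `Quot (LeftOrbitRel 𝒢 E)` the orbit
space `G\Z`, each with the quotient topology. -/
structure IsEquivalence [TopologicalSpace G₀] [TopologicalSpace G] [TopologicalSpace H₀]
    [TopologicalSpace H] [TopologicalSpace Z] (𝒢 : GroupoidStr G₀ G) (ℋ : GroupoidStr H₀ H)
    (E : BiactionStr G₀ G H₀ H Z) : Prop where
  t2 : T2Space Z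
  locallyCompact : LocallyCompactSpace Z
  secondCountable : SecondCountableTopology Z
  left : IsFreeProperLeftSpace 𝒢 E
  right : IsFreeProperRightSpace ℋ E
  commute : ∀ γ z η, 𝒢.s γ = E.r z → E.s z = ℋ.r η →
    E.ract (E.lact γ z) η = E.lact γ (E.ract z η)
  r_induces : ∃ e : Quot (RightOrbitRel ℋ E) ≃ₜ G₀, ∀ z, e (Quot.mk _ z) = E.r z
  s_induces : ∃ e : Quot (LeftOrbitRel 𝒢 E) ≃ₜ H₀, ∀ z, e (Quot.mk _ z) = E.s z

/-- The opposite space `Z^op` (the copy `Zᵐᵒᵖ` of `Z`, with `z̄ = MulOpposite.op z`), on which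
`H` acts on the left by `η • z̄ = (z • η⁻¹)‾` and `G` on the right by `z̄ • γ = (γ⁻¹ • z)‾`. -/
def BiactionStr.op (𝒢 : GroupoidStr G₀ G) (ℋ : GroupoidStr H₀ H)
    (E : BiactionStr G₀ G H₀ H Z) : BiactionStr H₀ H G₀ G Zᵐᵒᵖ where
  r z := E.s z.unop
  s z := E.r z.unop
  lact η z := MulOpposite.op (E.ract z.unop (ℋ.inv η))
  ract z γ := MulOpposite.op (E.lact (𝒢.inv γ) z.unop)

open Classical in
/-- `_G[y, z]`: the element `γ` of `G` with `γ • z = y` (meaningful when `s y = s z`). -/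
def leftBracket (𝒢 : GroupoidStr G₀ G) (E : BiactionStr G₀ G H₀ H Z) (y z : Z) : G :=
  if h : ∃ γ, 𝒢.s γ = E.r z ∧ E.lact γ z = y then h.choose else 𝒢.unit (E.r y)

open Classical in
/-- `[y, z]_H`: the element `η` of `H` with `y • η = z` (meaningful when `r y = r z`). -/
def rightBracket (ℋ : GroupoidStr H₀ H) (E : BiactionStr G₀ G H₀ H Z) (y z : Z) : H :=
  if h : ∃ η, E.s y = ℋ.r η ∧ E.ract y η = z then h.choose else ℋ.unit (E.s y)

/-! ### The linking groupoid -/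

/-- The topological disjoint union `L = G ⊔ Z ⊔ Z^op ⊔ H`. -/
abbrev LinkingSpace (G : Type u₂) (Z : Type u₅) (H : Type u₄) : Type (max u₂ u₅ u₄) :=
  (G ⊕ Z) ⊕ (Zᵐᵒᵖ ⊕ H)

/-- The inclusion of `G` in `L`. -/
abbrev ofG (γ : G) : LinkingSpace G Z H := .inl (.inl γ)

/-- The inclusion of `Z` in `L`. -/
abbrev ofZ (z : Z) : LinkingSpace G Z H := .inl (.inr z)

/-- The inclusion of `Z^op` in `L`. -/
abbrev ofZop (z : Zᵐᵒᵖ) : LinkingSpace G Z H := .inr (.inl z)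

/-- The inclusion of `H` in `L`. -/
abbrev ofH (η : H) : LinkingSpace G Z H := .inr (.inr η)

/-- The product of `L`: the products of `G` and `H`, the actions of `G` and `H` on `Z` and `Z^op`,
`z ȳ = _G[z, y]` and `ȳ z = [y, z]_H`.  The last case concerns no composable pair. -/
def linkingMul (𝒢 : GroupoidStr G₀ G) (ℋ : GroupoidStr H₀ H) (E : BiactionStr G₀ G H₀ H Z) :
    LinkingSpace G Z H → LinkingSpace G Z H → LinkingSpace G Z H
  | .inl (.inl γ), .inl (.inl γ') => ofG (𝒢.mul γ γ')
  | .inl (.inl γ), .inl (.inr z) => ofZ (E.lact γ z)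
  | .inl (.inr z), .inr (.inl y) => ofG (leftBracket 𝒢 E z y.unop)
  | .inl (.inr z), .inr (.inr η) => ofZ (E.ract z η)
  | .inr (.inl y), .inl (.inl γ) => ofZop ((E.op 𝒢 ℋ).ract y γ)
  | .inr (.inl y), .inl (.inr z) => ofH (rightBracket ℋ E y.unop z)
  | .inr (.inr η), .inr (.inl y) => ofZop ((E.op 𝒢 ℋ).lact η y)
  | .inr (.inr η), .inr (.inr η') => ofH (ℋ.mul η η')
  | k, _ => k

/-- The operations of the linking groupoid `L`, with unit space `L₀ = G₀ ⊔ H₀`. -/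
def linking (𝒢 : GroupoidStr G₀ G) (ℋ : GroupoidStr H₀ H) (E : BiactionStr G₀ G H₀ H Z) :
    GroupoidStr (G₀ ⊕ H₀) (LinkingSpace G Z H) where
  r
  | .inl (.inl γ) => .inl (𝒢.r γ)
  | .inl (.inr z) => .inl (E.r z)
  | .inr (.inl y) => .inr ((E.op 𝒢 ℋ).r y)
  | .inr (.inr η) => .inr (ℋ.r η)
  s
  | .inl (.inl γ) => .inl (𝒢.s γ)
  | .inl (.inr z) => .inr (E.s z)
  | .inr (.inl y) => .inl ((E.op 𝒢 ℋ).s y)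
  | .inr (.inr η) => .inr (ℋ.s η)
  unit
  | .inl u => ofG (𝒢.unit u)
  | .inr v => ofH (ℋ.unit v)
  mul := linkingMul 𝒢 ℋ E
  inv
  | .inl (.inl γ) => ofG (𝒢.inv γ)
  | .inl (.inr z) => ofZop (MulOpposite.op z)
  | .inr (.inl y) => ofZ y.unop
  | .inr (.inr η) => ofH (ℋ.inv η)

/-- The defining property of the family `σ_Z`: `σ u` is a Radon measure on `Z` such that
`∫ φ d(σ u) = ∫ φ(z • η) d(β (s z))(η)` for every `φ ∈ C_c(Z)` and every `z` with `r z = u`. -/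
def IsOrbitSystem [TopologicalSpace Z] [MeasurableSpace Z] [MeasurableSpace H]
    (E : BiactionStr G₀ G H₀ H Z) (β : H₀ → Measure H) (σ : G₀ → Measure Z) : Prop :=
  ∀ u, (σ u).Regular ∧ ∀ z, E.r z = u → ∀ φ : C_c(Z, ℂ),
    ∫ w, φ w ∂(σ u) = ∫ η, φ (E.ract z η) ∂(β (E.s z))

/-- The defining property of the family `κ` on `L`: each `κ w` is a Radon measure on `L`, given on
`F ∈ C_c(L)` by `lam u (F|G) + σ u (F|Z)` if `w = u ∈ G₀`, and by
`τ v (F|Z^op) + β v (F|H)` if `w = v ∈ H₀`. -/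
structure IsLinkingSystem [TopologicalSpace G] [TopologicalSpace H] [TopologicalSpace Z]
    [MeasurableSpace G] [MeasurableSpace H] [MeasurableSpace Z]
    (lam : G₀ → Measure G) (β : H₀ → Measure H) (σ : G₀ → Measure Z) (τ : H₀ → Measure Zᵐᵒᵖ)
    (κ : G₀ ⊕ H₀ → Measure (LinkingSpace G Z H)) : Prop where
  regular : ∀ w, (κ w).Regular
  integral_inl : ∀ (u : G₀) (F : C_c(LinkingSpace G Z H, ℂ)),
    ∫ l, F l ∂(κ (.inl u)) = ∫ γ, F (ofG γ) ∂(lam u) + ∫ z, F (ofZ z) ∂(σ u)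
  integral_inr : ∀ (v : H₀) (F : C_c(LinkingSpace G Z H, ℂ)),
    ∫ l, F l ∂(κ (.inr v)) = ∫ y, F (ofZop y) ∂(τ v) + ∫ η, F (ofH η) ∂(β v)

end Equivalence

/-! The σ-algebras that Mathlib puts on a copy `Zᵐᵒᵖ` and on a disjoint union, and hence on `L`,
are the Borel ones. -/

instance borelSpace_op {X : Type u₁} [TopologicalSpace X] [MeasurableSpace X] [BorelSpace X] :
    BorelSpace Xᵐᵒᵖ := by
  refine ⟨le_antisymm ?_ ?_⟩
  · intro t ht
    have h1 : MeasurableSet (MulOpposite.op ⁻¹' t : Set X) := ht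
    have h2 : Measurable[borel Xᵐᵒᵖ] (MulOpposite.unop : Xᵐᵒᵖ → X) := by
      let _ : MeasurableSpace Xᵐᵒᵖ := borel _
      have : BorelSpace Xᵐᵒᵖ := ⟨rfl⟩
      exact MulOpposite.continuous_unop.measurable
    exact h2 h1
  · refine MeasurableSpace.generateFrom_le fun t ht => ?_
    exact (ht.preimage MulOpposite.continuous_op).measurableSet

instance borelSpace_sum {X : Type u₁} {Y : Type u₂} [TopologicalSpace X] [TopologicalSpace Y]
    [MeasurableSpace X] [MeasurableSpace Y] [BorelSpace X] [BorelSpace Y] :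
    BorelSpace (X ⊕ Y) := by
  refine ⟨le_antisymm ?_ ?_⟩
  · intro t ht
    have h1 : MeasurableSet (Sum.inl ⁻¹' t : Set X) := (measurableSet_sum_iff.1 ht).1
    have h2 : MeasurableSet (Sum.inr ⁻¹' t : Set Y) := (measurableSet_sum_iff.1 ht).2
    let _ : MeasurableSpace (X ⊕ Y) := borel _
    have : BorelSpace (X ⊕ Y) := ⟨rfl⟩
    rw [← Set.image_preimage_inl_union_image_preimage_inr t]
    exact (IsOpenEmbedding.inl.measurableEmbedding.measurableSet_image.2 h1).union
      (IsOpenEmbedding.inr.measurableEmbedding.measurableSet_image.2 h2)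
  · refine MeasurableSpace.generateFrom_le fun t ht => measurableSet_sum_iff.2 ⟨?_, ?_⟩
    · exact (ht.preimage continuous_inl).measurableSet
    · exact (ht.preimage continuous_inr).measurableSet

end GroupoidEquiv

end

noncomputable section

namespace GroupoidEquiv

universe u₁ u₂ u₃ u₄ u₅

/-! ### Algebra in groupoids -/

namespace GroupoidStr.IsGroupoid

variable {G₀ : Type u₁} {G : Type u₂} {𝒢 : GroupoidStr G₀ G}

/-! Algebraically, `L` is a groupoid because freeness makes the brackets unique: `leftBracket` is
the only `γ` carrying one point of a fibre of `s` to another, and such a `γ` exists because the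
`G`-orbits are exactly the fibres of `s`; the same holds for `H`, `r` and `rightBracket`. Each
groupoid identity then reduces to the action axioms and the commutation of the two actions. Freeness
and properness together make `(γ, z) ↦ (γ • z, z)` a closed embedding, and continuity of its inverse
is continuity of the bracket.

For the measures, `σ u` is the image of `β (s z)` under the orbit map `η ↦ z • η`, for any `z` over
`u`. Left invariance of `β` shows that it does not depend on `z` (`map_ract_eq`), and properness
makes it finite on compact sets. Continuity in `u` is the delicate point, because the domain of the
orbit map moves with `z`. Near `z₀` the function `η ↦ φ (z • η)` is compared with one fixed `F ∈
C_c(H)`, the error being at most a small multiple of a fixed `χ ∈ C_c(H)`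
(`eventually_norm_comp_ract_sub_le`); then the continuity axiom for `β` applies to `F` and `χ`. The
notion `IsRightPrincipal` covers `Z` with `H` and `Z^op` with `G`, so the analysis is done once.

Left invariance of `κ` is proved for measures rather than integrals: left multiplication by `k`
carries `κ (s k)` to `κ (r k)` (`map_linkingMul_linkingMeasure`). Each half of `κ` is the image of
one Haar measure under a parametrization, and multiplication by `k` intertwines the
parametrizations. -/

theorem inv_mul_cancel_left (h : 𝒢.IsGroupoid) {x y : G} (hxy : 𝒢.s x = 𝒢.r y) :
    𝒢.mul (𝒢.inv x) (𝒢.mul x y) = y := by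
  rw [← h.mul_assoc _ _ _ (h.s_inv x) hxy, h.inv_mul, hxy, h.unit_mul]

theorem mul_left_cancel (h : 𝒢.IsGroupoid) {x y z : G} (hxy : 𝒢.s x = 𝒢.r y)
    (hxz : 𝒢.s x = 𝒢.r z) (e : 𝒢.mul x y = 𝒢.mul x z) : y = z := by
  rw [← h.inv_mul_cancel_left hxy, e, h.inv_mul_cancel_left hxz]

theorem mul_inv_cancel_left (h : 𝒢.IsGroupoid) {x y : G} (hxy : 𝒢.r x = 𝒢.r y) :
    𝒢.mul x (𝒢.mul (𝒢.inv x) y) = y := by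
  rw [← h.mul_assoc _ _ _ (h.r_inv x).symm ((h.s_inv x).trans hxy), h.mul_inv, hxy, h.unit_mul]

theorem eq_inv_of_mul_eq_unit (h : 𝒢.IsGroupoid) {x y : G} (hxy : 𝒢.s x = 𝒢.r y)
    (e : 𝒢.mul x y = 𝒢.unit (𝒢.r x)) : y = 𝒢.inv x :=
  h.mul_left_cancel hxy (h.r_inv x).symm (e.trans (h.mul_inv x).symm)

theorem inv_inv (h : 𝒢.IsGroupoid) (x : G) : 𝒢.inv (𝒢.inv x) = x :=
  (h.eq_inv_of_mul_eq_unit (h.s_inv x) (by rw [h.inv_mul, h.r_inv])).symm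

theorem inv_unit (h : 𝒢.IsGroupoid) (u : G₀) : 𝒢.inv (𝒢.unit u) = 𝒢.unit u := by
  refine (h.eq_inv_of_mul_eq_unit (by rw [h.s_unit, h.r_unit]) ?_).symm
  have := h.mul_unit (𝒢.unit u)
  rw [h.s_unit] at this
  rw [this, h.r_unit]

theorem mul_inv_rev (h : 𝒢.IsGroupoid) {x y : G} (hxy : 𝒢.s x = 𝒢.r y) :
    𝒢.inv (𝒢.mul x y) = 𝒢.mul (𝒢.inv y) (𝒢.inv x) := by
  have h1 : 𝒢.s (𝒢.inv y) = 𝒢.r (𝒢.inv x) := by rw [h.s_inv, h.r_inv, hxy]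
  refine (h.eq_inv_of_mul_eq_unit ?_ ?_).symm
  · rw [h.s_mul _ _ hxy, h.r_mul _ _ h1, h.r_inv]
  · rw [h.mul_assoc _ _ _ hxy (by rw [h.r_mul _ _ h1, h.r_inv]), h.mul_inv_cancel_left
      (by rw [h.r_inv, hxy]), h.mul_inv, h.r_mul _ _ hxy]

theorem inv_eq_unit (h : 𝒢.IsGroupoid) {x : G} {u : G₀} (e : 𝒢.inv x = 𝒢.unit u) :
    x = 𝒢.unit u := by
  rw [← h.inv_inv x, e, h.inv_unit]

end GroupoidStr.IsGroupoid

theorem GroupoidStr.IsLocallyCompactGroupoid.t2_unitSpace {G₀ : Type u₁} {G : Type u₂}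
    [TopologicalSpace G₀] [TopologicalSpace G] {𝒢 : GroupoidStr G₀ G}
    (h : 𝒢.IsLocallyCompactGroupoid) : T2Space G₀ := by
  have := h.t2
  exact .of_injective_continuous (f := 𝒢.unit)
    (Function.LeftInverse.injective (g := 𝒢.r) h.r_unit) h.continuous_unit

/-! ### Cancellation for free right actions -/

section RightSpace

variable {G₀ : Type u₁} {G : Type u₂} {H₀ : Type u₃} {H : Type u₄} {Z : Type u₅}
  [TopologicalSpace H₀] [TopologicalSpace H] [TopologicalSpace Z]
  {ℋ : GroupoidStr H₀ H} {E : BiactionStr G₀ G H₀ H Z}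

theorem IsFreeProperRightSpace.ract_ract_inv (h : IsFreeProperRightSpace ℋ E)
    (hℋ : ℋ.IsGroupoid) {z : Z} {η : H} (hz : E.s z = ℋ.r η) :
    E.ract (E.ract z η) (ℋ.inv η) = z := by
  rw [← h.ract_mul _ _ _ hz (hℋ.r_inv η).symm, hℋ.mul_inv, ← hz, h.ract_unit]

theorem IsFreeProperRightSpace.ract_inv_ract (h : IsFreeProperRightSpace ℋ E)
    (hℋ : ℋ.IsGroupoid) {z : Z} {η : H} (hz : E.s z = ℋ.s η) :
    E.ract (E.ract z (ℋ.inv η)) η = z := by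
  have := h.ract_ract_inv hℋ (hz.trans (hℋ.r_inv η).symm)
  rwa [hℋ.inv_inv] at this

/-- Freeness only speaks of elements fixing a point; here `η ζ⁻¹` fixes `z`, hence is a unit. -/
theorem IsFreeProperRightSpace.ract_cancel (h : IsFreeProperRightSpace ℋ E)
    (hℋ : ℋ.IsGroupoid) {z : Z} {η ζ : H} (hη : E.s z = ℋ.r η) (hζ : E.s z = ℋ.r ζ)
    (e : E.ract z η = E.ract z ζ) : η = ζ := by
  have hs : ℋ.s η = ℋ.s ζ := by rw [← h.s_ract _ _ hη, e, h.s_ract _ _ hζ]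
  have h1 : ℋ.s η = ℋ.r (ℋ.inv ζ) := by rw [hℋ.r_inv, hs]
  have h2 : ℋ.mul η (ℋ.inv ζ) = ℋ.unit (E.s z) := by
    refine h.free z _ (by rw [hℋ.r_mul _ _ h1, hη]) ?_
    rw [h.ract_mul _ _ _ hη h1, e, h.ract_ract_inv hℋ hζ]
  have h3 := hℋ.eq_inv_of_mul_eq_unit h1 (by rw [h2, hη])
  rw [← hℋ.inv_inv η, ← h3, hℋ.inv_inv]

end RightSpace

/-! ### Free left actions, and their conversion to right actions on the opposite space -/

section LeftSpace

variable {G₀ : Type u₁} {G : Type u₂} {H₀ : Type u₃} {H : Type u₄} {Z : Type u₅}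
  [TopologicalSpace G₀] [TopologicalSpace G] [TopologicalSpace Z]
  {𝒢 : GroupoidStr G₀ G} {ℋ : GroupoidStr H₀ H} {E : BiactionStr G₀ G H₀ H Z}

theorem IsFreeProperLeftSpace.lact_inv_lact (h : IsFreeProperLeftSpace 𝒢 E)
    (h𝒢 : 𝒢.IsGroupoid) {z : Z} {γ : G} (hz : 𝒢.s γ = E.r z) :
    E.lact (𝒢.inv γ) (E.lact γ z) = z := by
  rw [← h.mul_lact _ _ _ (h𝒢.s_inv γ) hz, h𝒢.inv_mul, hz, h.unit_lact]

theorem IsFreeProperLeftSpace.lact_lact_inv (h : IsFreeProperLeftSpace 𝒢 E)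
    (h𝒢 : 𝒢.IsGroupoid) {z : Z} {γ : G} (hz : 𝒢.r γ = E.r z) :
    E.lact γ (E.lact (𝒢.inv γ) z) = z := by
  rw [← h.mul_lact _ _ _ (h𝒢.r_inv γ).symm ((h𝒢.s_inv γ).trans hz), h𝒢.mul_inv, hz, h.unit_lact]

theorem IsFreeProperLeftSpace.lact_cancel (h : IsFreeProperLeftSpace 𝒢 E)
    (h𝒢 : 𝒢.IsGroupoid) {z : Z} {γ δ : G} (hγ : 𝒢.s γ = E.r z) (hδ : 𝒢.s δ = E.r z)
    (e : E.lact γ z = E.lact δ z) : γ = δ := by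
  have hr : 𝒢.r γ = 𝒢.r δ := by rw [← h.r_lact _ _ hγ, e, h.r_lact _ _ hδ]
  have h1 : 𝒢.s (𝒢.inv δ) = 𝒢.r γ := by rw [h𝒢.s_inv, hr]
  have h2 : 𝒢.mul (𝒢.inv δ) γ = 𝒢.unit (E.r z) := by
    refine h.free _ z (by rw [h𝒢.s_mul _ _ h1, hγ]) ?_
    rw [h.mul_lact _ _ _ h1 hγ, e, h.lact_inv_lact h𝒢 hδ]
  have h3 := h𝒢.eq_inv_of_mul_eq_unit h1 (by rw [h2, h𝒢.r_inv, hδ])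
  rw [h3, h𝒢.inv_inv]

/-- Inversion in `G` turns one action into the other, and the two maps required to be proper differ
by homeomorphisms. This is what lets results about right spaces apply to `Z^op`. -/
theorem IsFreeProperLeftSpace.right_op (h : IsFreeProperLeftSpace 𝒢 E)
    (h𝒢 : 𝒢.IsLocallyCompactGroupoid) :
    IsFreeProperRightSpace 𝒢 (E.op 𝒢 ℋ) where
  continuous_s := h.continuous_r.comp MulOpposite.continuous_unop
  isOpenMap_s := h.isOpenMap_r.comp MulOpposite.opHomeomorph.symm.isOpenMap
  continuousOn_ract := by
    refine MulOpposite.continuous_op.comp_continuousOn (h.continuousOn_lact.comp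
      (f := fun p : Zᵐᵒᵖ × G => (𝒢.inv p.2, p.1.unop)) ?_ ?_)
    · exact ((h𝒢.continuous_inv.comp continuous_snd).prodMk
        (MulOpposite.continuous_unop.comp continuous_fst)).continuousOn
    · rintro ⟨z, γ⟩ hp
      exact (h𝒢.s_inv γ).trans (Eq.symm hp)
  s_ract z γ hz := (h.r_lact _ _ ((h𝒢.s_inv γ).trans hz.symm)).trans (h𝒢.r_inv γ)
  ract_unit z := by
    simp [BiactionStr.op, h𝒢.toIsGroupoid.inv_unit, h.unit_lact]
  ract_mul z γ δ hz hγ := by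
    simp only [BiactionStr.op, MulOpposite.unop_op, MulOpposite.op_inj] at hz ⊢
    rw [h𝒢.toIsGroupoid.mul_inv_rev hγ,
      h.mul_lact _ _ _ (by rw [h𝒢.s_inv, h𝒢.r_inv, hγ]) (by rw [h𝒢.s_inv, hz])]
  free z γ hz e := by
    refine h𝒢.toIsGroupoid.inv_eq_unit (h.free _ _ ((h𝒢.s_inv γ).trans hz.symm) ?_)
    exact MulOpposite.op_injective e
  proper := by
    let e : {p : Zᵐᵒᵖ × G // (E.op 𝒢 ℋ).s p.1 = 𝒢.r p.2} ≃ₜ {p : G × Z // 𝒢.s p.1 = E.r p.2} :=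
      { toFun := fun p => ⟨(𝒢.inv p.1.2, p.1.1.unop), (h𝒢.s_inv _).trans p.2.symm⟩
        invFun := fun p => ⟨(MulOpposite.op p.1.2, 𝒢.inv p.1.1), p.2.symm.trans (h𝒢.r_inv _).symm⟩
        left_inv := fun p => by simp [h𝒢.toIsGroupoid.inv_inv]
        right_inv := fun p => by simp [h𝒢.toIsGroupoid.inv_inv]
        continuous_toFun := by
          have := h𝒢.continuous_inv
          have := MulOpposite.continuous_unop (M := Z)
          fun_prop
        continuous_invFun := by
          have := h𝒢.continuous_inv
          have := MulOpposite.continuous_op (M := Z)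
          fun_prop }
    exact ((MulOpposite.opHomeomorph.prodCongr MulOpposite.opHomeomorph).isProperMap.comp
      h.proper).comp e.isProperMap

end LeftSpace

/-! ### Orbits as fibres of the structure maps, brackets, and the algebra of `L` -/

section Equivalence

variable {G₀ : Type u₁} {G : Type u₂} {H₀ : Type u₃} {H : Type u₄} {Z : Type u₅}
  [TopologicalSpace G₀] [TopologicalSpace G] [TopologicalSpace H₀] [TopologicalSpace H]
  [TopologicalSpace Z]
  {𝒢 : GroupoidStr G₀ G} {ℋ : GroupoidStr H₀ H} {E : BiactionStr G₀ G H₀ H Z}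

/-- `Z` is a free and proper right `H`-space whose orbits are the fibres of the open continuous
surjection `r : Z → G₀`. -/
structure IsRightPrincipal (ℋ : GroupoidStr H₀ H) (E : BiactionStr G₀ G H₀ H Z) : Prop where
  right : IsFreeProperRightSpace ℋ E
  continuous_r : Continuous E.r
  isOpenMap_r : IsOpenMap E.r
  surjective_r : Function.Surjective E.r
  r_ract : ∀ z η, E.s z = ℋ.r η → E.r (E.ract z η) = E.r z
  exists_ract : ∀ z w, E.r z = E.r w → ∃ η, E.s z = ℋ.r η ∧ E.ract z η = w

namespace IsEquivalence

theorem rightPrincipal (hE : IsEquivalence 𝒢 ℋ E) (hℋ : ℋ.IsGroupoid) :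
    IsRightPrincipal ℋ E where
  right := hE.right
  continuous_r := hE.left.continuous_r
  isOpenMap_r := hE.left.isOpenMap_r
  surjective_r u := by
    obtain ⟨e, he⟩ := hE.r_induces
    obtain ⟨z, hz⟩ := Quot.exists_rep (e.symm u)
    exact ⟨z, by rw [← he, hz, e.apply_symm_apply]⟩
  r_ract z η hz := by
    obtain ⟨e, he⟩ := hE.r_induces
    rw [← he, ← he]
    exact congrArg e (Quot.sound ⟨η, hz, rfl⟩).symm
  exists_ract z w hzw := by
    obtain ⟨e, he⟩ := hE.r_induces
    rw [← he, ← he] at hzw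
    -- Equality in `Quot` only gives the equivalence relation generated by the orbit relation.
    -- Units, inverses and products show that the orbit relation is already an equivalence.
    refine Quot.eqvGen_exact (e.injective hzw) |>.rec ?_ ?_ ?_ ?_
    · exact fun _ _ h => h
    · exact fun z => ⟨ℋ.unit (E.s z), (hℋ.r_unit _).symm, hE.right.ract_unit z⟩
    · rintro x y - ⟨η, h1, rfl⟩
      exact ⟨ℋ.inv η, by rw [hE.right.s_ract _ _ h1, hℋ.r_inv], hE.right.ract_ract_inv hℋ h1⟩
    · rintro x y z - - ⟨η, h1, rfl⟩ ⟨ζ, h2, rfl⟩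
      rw [hE.right.s_ract _ _ h1] at h2
      exact ⟨ℋ.mul η ζ, by rw [hℋ.r_mul _ _ h2, h1], hE.right.ract_mul _ _ _ h1 h2⟩

theorem s_lact (hE : IsEquivalence 𝒢 ℋ E) {γ : G} {z : Z} (hz : 𝒢.s γ = E.r z) :
    E.s (E.lact γ z) = E.s z := by
  obtain ⟨e, he⟩ := hE.s_induces
  rw [← he, ← he]
  exact congrArg e (Quot.sound ⟨γ, hz, rfl⟩).symm

theorem r_ract (hE : IsEquivalence 𝒢 ℋ E) {η : H} {z : Z} (hz : E.s z = ℋ.r η) :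
    E.r (E.ract z η) = E.r z := by
  obtain ⟨e, he⟩ := hE.r_induces
  rw [← he, ← he]
  exact congrArg e (Quot.sound ⟨η, hz, rfl⟩).symm

theorem exists_lact (hE : IsEquivalence 𝒢 ℋ E) (h𝒢 : 𝒢.IsGroupoid) {z w : Z}
    (hzw : E.s z = E.s w) : ∃ γ, 𝒢.s γ = E.r z ∧ E.lact γ z = w := by
  obtain ⟨e, he⟩ := hE.s_induces
  rw [← he, ← he] at hzw
  refine Quot.eqvGen_exact (e.injective hzw) |>.rec ?_ ?_ ?_ ?_
  · exact fun _ _ h => h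
  · exact fun z => ⟨𝒢.unit (E.r z), h𝒢.s_unit _, hE.left.unit_lact z⟩
  · rintro x y - ⟨γ, h1, rfl⟩
    exact ⟨𝒢.inv γ, by rw [hE.left.r_lact _ _ h1, h𝒢.s_inv], hE.left.lact_inv_lact h𝒢 h1⟩
  · rintro x y z - - ⟨γ, h1, rfl⟩ ⟨δ, h2, rfl⟩
    rw [hE.left.r_lact _ _ h1] at h2
    exact ⟨𝒢.mul δ γ, by rw [h𝒢.s_mul _ _ h2, h1], hE.left.mul_lact _ _ _ h2 h1⟩

theorem rightPrincipal_op (hE : IsEquivalence 𝒢 ℋ E) (h𝒢 : 𝒢.IsLocallyCompactGroupoid) :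
    IsRightPrincipal 𝒢 (E.op 𝒢 ℋ) where
  right := hE.left.right_op h𝒢
  continuous_r := hE.right.continuous_s.comp MulOpposite.continuous_unop
  isOpenMap_r := hE.right.isOpenMap_s.comp MulOpposite.opHomeomorph.symm.isOpenMap
  surjective_r v := by
    obtain ⟨e, he⟩ := hE.s_induces
    obtain ⟨z, hz⟩ := Quot.exists_rep (e.symm v)
    exact ⟨MulOpposite.op z, (he z).symm.trans (by rw [hz, e.apply_symm_apply])⟩
  r_ract z γ hz := hE.s_lact ((h𝒢.s_inv γ).trans hz.symm)
  exists_ract z w hzw := by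
    obtain ⟨γ, h1, h2⟩ := hE.exists_lact h𝒢.toIsGroupoid hzw
    refine ⟨𝒢.inv γ, h1.symm.trans (h𝒢.r_inv γ).symm, MulOpposite.unop_injective ?_⟩
    simpa [BiactionStr.op, h𝒢.toIsGroupoid.inv_inv] using h2

/-! ### The brackets -/

/-- By freeness the chosen element is the only one with its property, so a bracket is computed by
exhibiting any such element. -/
theorem leftBracket_eq (hE : IsEquivalence 𝒢 ℋ E) (h𝒢 : 𝒢.IsGroupoid) {y z : Z} {γ : G}
    (h1 : 𝒢.s γ = E.r z) (h2 : E.lact γ z = y) : leftBracket 𝒢 E y z = γ := by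
  have h : ∃ γ, 𝒢.s γ = E.r z ∧ E.lact γ z = y := ⟨γ, h1, h2⟩
  rw [leftBracket, dif_pos h]
  exact hE.left.lact_cancel h𝒢 h.choose_spec.1 h1 (h.choose_spec.2.trans h2.symm)

theorem rightBracket_eq (hE : IsEquivalence 𝒢 ℋ E) (hℋ : ℋ.IsGroupoid) {y z : Z} {η : H}
    (h1 : E.s y = ℋ.r η) (h2 : E.ract y η = z) : rightBracket ℋ E y z = η := by
  have h : ∃ η, E.s y = ℋ.r η ∧ E.ract y η = z := ⟨η, h1, h2⟩
  rw [rightBracket, dif_pos h]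
  exact hE.right.ract_cancel hℋ h.choose_spec.1 h1 (h.choose_spec.2.trans h2.symm)

theorem s_leftBracket (hE : IsEquivalence 𝒢 ℋ E) (h𝒢 : 𝒢.IsGroupoid) {y z : Z}
    (h : E.s y = E.s z) : 𝒢.s (leftBracket 𝒢 E y z) = E.r z := by
  obtain ⟨γ, h1, h2⟩ := hE.exists_lact h𝒢 h.symm
  rw [hE.leftBracket_eq h𝒢 h1 h2, h1]

theorem leftBracket_lact (hE : IsEquivalence 𝒢 ℋ E) (h𝒢 : 𝒢.IsGroupoid) {y z : Z}
    (h : E.s y = E.s z) : E.lact (leftBracket 𝒢 E y z) z = y := by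
  obtain ⟨γ, h1, h2⟩ := hE.exists_lact h𝒢 h.symm
  rw [hE.leftBracket_eq h𝒢 h1 h2, h2]

theorem r_leftBracket (hE : IsEquivalence 𝒢 ℋ E) (h𝒢 : 𝒢.IsGroupoid) {y z : Z}
    (h : E.s y = E.s z) : 𝒢.r (leftBracket 𝒢 E y z) = E.r y := by
  rw [← hE.left.r_lact _ _ (hE.s_leftBracket h𝒢 h), hE.leftBracket_lact h𝒢 h]

theorem r_rightBracket (hE : IsEquivalence 𝒢 ℋ E) (hℋ : ℋ.IsGroupoid) {y z : Z}
    (h : E.r y = E.r z) : ℋ.r (rightBracket ℋ E y z) = E.s y := by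
  obtain ⟨η, h1, h2⟩ := (hE.rightPrincipal hℋ).exists_ract _ _ h
  rw [hE.rightBracket_eq hℋ h1 h2, h1]

theorem ract_rightBracket (hE : IsEquivalence 𝒢 ℋ E) (hℋ : ℋ.IsGroupoid) {y z : Z}
    (h : E.r y = E.r z) : E.ract y (rightBracket ℋ E y z) = z := by
  obtain ⟨η, h1, h2⟩ := (hE.rightPrincipal hℋ).exists_ract _ _ h
  rw [hE.rightBracket_eq hℋ h1 h2, h2]

theorem s_rightBracket (hE : IsEquivalence 𝒢 ℋ E) (hℋ : ℋ.IsGroupoid) {y z : Z}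
    (h : E.r y = E.r z) : ℋ.s (rightBracket ℋ E y z) = E.s z := by
  rw [← hE.right.s_ract _ _ (hE.r_rightBracket hℋ h).symm, hE.ract_rightBracket hℋ h]

/-- The map `θ` is injective by freeness and closed by properness, hence a closed embedding. The
bracket is the first coordinate of its inverse, so it is continuous. -/
theorem continuousOn_leftBracket (hE : IsEquivalence 𝒢 ℋ E) (h𝒢 : 𝒢.IsGroupoid) :
    ContinuousOn (fun p : Z × Z => leftBracket 𝒢 E p.1 p.2) {p | E.s p.1 = E.s p.2} := by
  let θ : {p : G × Z // 𝒢.s p.1 = E.r p.2} → Z × Z := fun p => (E.lact p.1.1 p.1.2, p.1.2)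
  have hθ : IsClosedEmbedding θ := by
    refine .of_continuous_injective_isClosedMap hE.left.proper.continuous ?_
      hE.left.proper.isClosedMap
    rintro ⟨⟨γ, z⟩, h1⟩ ⟨⟨δ, w⟩, h2⟩ e
    obtain ⟨e1, rfl⟩ := Prod.mk.inj e
    obtain rfl := hE.left.lact_cancel h𝒢 h1 h2 e1
    rfl
  rw [continuousOn_iff_continuous_domRestrict]
  let j : {p : Z × Z | E.s p.1 = E.s p.2} → {p : G × Z // 𝒢.s p.1 = E.r p.2} := fun p =>
    ⟨(leftBracket 𝒢 E p.1.1 p.1.2, p.1.2), hE.s_leftBracket h𝒢 p.2⟩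
  have hj : Continuous j := by
    rw [hθ.isEmbedding.continuous_iff]
    convert continuous_subtype_val using 1
    ext p
    · exact hE.leftBracket_lact h𝒢 p.2
    · rfl
  exact continuous_fst.comp (continuous_subtype_val.comp hj)

theorem continuousOn_rightBracket (hE : IsEquivalence 𝒢 ℋ E) (hℋ : ℋ.IsGroupoid) :
    ContinuousOn (fun p : Z × Z => rightBracket ℋ E p.1 p.2) {p | E.r p.1 = E.r p.2} := by
  let θ : {p : Z × H // E.s p.1 = ℋ.r p.2} → Z × Z := fun p => (E.ract p.1.1 p.1.2, p.1.1)
  have hθ : IsClosedEmbedding θ := by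
    refine .of_continuous_injective_isClosedMap hE.right.proper.continuous ?_
      hE.right.proper.isClosedMap
    rintro ⟨⟨z, η⟩, h1⟩ ⟨⟨w, ζ⟩, h2⟩ e
    obtain ⟨e1, rfl⟩ := Prod.mk.inj e
    obtain rfl := hE.right.ract_cancel hℋ h1 h2 e1
    rfl
  rw [continuousOn_iff_continuous_domRestrict]
  let j : {p : Z × Z | E.r p.1 = E.r p.2} → {p : Z × H // E.s p.1 = ℋ.r p.2} := fun p =>
    ⟨(p.1.1, rightBracket ℋ E p.1.1 p.1.2), (hE.r_rightBracket hℋ p.2).symm⟩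
  have hj : Continuous j := by
    rw [hθ.isEmbedding.continuous_iff]
    convert continuous_swap.comp continuous_subtype_val using 1
    ext p
    · exact hE.ract_rightBracket hℋ p.2
    · rfl
  exact continuous_snd.comp (continuous_subtype_val.comp hj)

/-! ### The linking groupoid -/

theorem linking_isGroupoid (hE : IsEquivalence 𝒢 ℋ E) (h𝒢 : 𝒢.IsGroupoid)
    (hℋ : ℋ.IsGroupoid) : (linking 𝒢 ℋ E).IsGroupoid where
  r_unit := by rintro (u | v) <;> simp [linking, h𝒢.r_unit, hℋ.r_unit]
  s_unit := by rintro (u | v) <;> simp [linking, h𝒢.s_unit, hℋ.s_unit]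
  r_mul := by
    rintro ((x | x) | (x | x)) ((y | y) | (y | y)) h <;>
      simp only [linking, linkingMul, BiactionStr.op, Sum.inl.injEq, Sum.inr.injEq,
        reduceCtorEq] at h ⊢
    · exact h𝒢.r_mul _ _ h
    · exact hE.left.r_lact _ _ h
    · exact hE.r_leftBracket h𝒢 h
    · exact hE.r_ract h
    · exact hE.s_lact ((h𝒢.s_inv _).trans h.symm)
    · exact hE.r_rightBracket hℋ h
    · exact (hE.right.s_ract _ _ (h.symm.trans (hℋ.r_inv _).symm)).trans (hℋ.s_inv _)
    · exact hℋ.r_mul _ _ h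
  s_mul := by
    rintro ((x | x) | (x | x)) ((y | y) | (y | y)) h <;>
      simp only [linking, linkingMul, BiactionStr.op, Sum.inl.injEq, Sum.inr.injEq,
        reduceCtorEq] at h ⊢
    · exact h𝒢.s_mul _ _ h
    · exact hE.s_lact h
    · exact hE.s_leftBracket h𝒢 h
    · exact hE.right.s_ract _ _ h
    · exact (hE.left.r_lact _ _ ((h𝒢.s_inv _).trans h.symm)).trans (h𝒢.r_inv _)
    · exact hE.s_rightBracket hℋ h
    · exact hE.r_ract (h.symm.trans (hℋ.r_inv _).symm)
    · exact hℋ.s_mul _ _ h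
  mul_assoc := by
    -- A composable triple is determined in kind by its four successive units, each in `G₀` or `H₀`;
    -- this leaves sixteen cases out of sixty-four.
    rintro ((x | x) | (x | x)) ((y | y) | (y | y)) ((z | z) | (z | z)) h k <;>
      simp only [linking, linkingMul, BiactionStr.op, Sum.inl.injEq, Sum.inr.injEq,
        reduceCtorEq, MulOpposite.unop_op, MulOpposite.op_inj] at h k ⊢
    · exact h𝒢.mul_assoc _ _ _ h k
    · exact hE.left.mul_lact _ _ _ h k
    · refine hE.leftBracket_eq h𝒢 ?_ ?_
      · rw [h𝒢.s_mul _ _ (by rw [hE.r_leftBracket h𝒢 k, h]), hE.s_leftBracket h𝒢 k]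
      · rw [hE.left.mul_lact _ _ _ (by rw [hE.r_leftBracket h𝒢 k, h]) (hE.s_leftBracket h𝒢 k),
          hE.leftBracket_lact h𝒢 k]
    · exact hE.commute _ _ _ h k
    · have h1 : 𝒢.s (𝒢.inv z) = E.r (MulOpposite.unop y) := by rw [h𝒢.s_inv, k]
      refine (hE.leftBracket_eq h𝒢 ?_ ?_).symm
      · rw [h𝒢.s_mul _ _ (by rw [hE.s_leftBracket h𝒢 h, k]), hE.left.r_lact _ _ h1, h𝒢.r_inv]
      · rw [hE.left.mul_lact _ _ _ (by rw [hE.s_leftBracket h𝒢 h, k])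
          (by rw [hE.left.r_lact _ _ h1, h𝒢.r_inv]), hE.left.lact_lact_inv h𝒢 k.symm,
          hE.leftBracket_lact h𝒢 h]
    -- The identity `_G[x, y] • z = x • [y, z]_H`: with `z = y • η`, both sides are `x • η`.
    · obtain ⟨η, h1, rfl⟩ := (hE.rightPrincipal hℋ).exists_ract _ _ k
      rw [hE.rightBracket_eq hℋ h1 rfl, ← hE.commute _ _ _ (hE.s_leftBracket h𝒢 h) h1,
        hE.leftBracket_lact h𝒢 h]
    · have h1 : E.s (MulOpposite.unop z) = ℋ.r (ℋ.inv y) := by rw [hℋ.r_inv, k]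
      have h2 : E.s x = E.s (E.ract (MulOpposite.unop z) (ℋ.inv y)) := by
        rw [hE.right.s_ract _ _ h1, hℋ.s_inv, h]
      refine hE.leftBracket_eq h𝒢 ?_ ?_
      · rw [hE.s_leftBracket h𝒢 h2, hE.r_ract h1]
      · have h3 := hE.commute (leftBracket 𝒢 E x (E.ract (MulOpposite.unop z) (ℋ.inv y)))
          _ y (hE.s_leftBracket h𝒢 h2) (by rw [hE.right.s_ract _ _ h1, hℋ.s_inv])
        rw [hE.leftBracket_lact h𝒢 h2, hE.right.ract_inv_ract hℋ k.symm] at h3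
        exact h3.symm
    · exact (hE.right.ract_mul _ _ _ h k).symm
    · rw [h𝒢.mul_inv_rev k, hE.left.mul_lact _ _ _ (by rw [h𝒢.s_inv, h𝒢.r_inv, k])
        (by rw [h𝒢.s_inv, h])]
    · have h1 : 𝒢.s (𝒢.inv y) = E.r (MulOpposite.unop x) := by rw [h𝒢.s_inv, h]
      have h2 : E.r (E.lact (𝒢.inv y) (MulOpposite.unop x)) = E.r z := by
        rw [hE.left.r_lact _ _ h1, h𝒢.r_inv, k]
      refine (hE.rightBracket_eq hℋ ?_ ?_).symm
      · rw [hE.r_rightBracket hℋ h2, hE.s_lact h1]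
      · have h3 := hE.commute y _ (rightBracket ℋ E (E.lact (𝒢.inv y) (MulOpposite.unop x)) z)
          (by rw [h2, k]) (hE.r_rightBracket hℋ h2).symm
        rw [hE.ract_rightBracket hℋ h2, hE.left.lact_lact_inv h𝒢 h.symm] at h3
        exact h3
    -- With `y = γ • z` and `x • η = γ • z`, the claim is `z • η⁻¹ = γ⁻¹ • x`, which follows from `x
    -- = γ • (z • η⁻¹)`.
    · obtain ⟨γ, h1, h1'⟩ := hE.exists_lact h𝒢 k.symm
      subst h1'
      rw [hE.leftBracket_eq h𝒢 h1 rfl]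
      have h2 : E.r (MulOpposite.unop x) = E.r (E.lact γ (MulOpposite.unop z)) := h
      have h3 := hE.r_rightBracket hℋ h2
      have h4 := hE.s_rightBracket hℋ h2
      have h5 := hE.ract_rightBracket hℋ h2
      generalize rightBracket ℋ E (MulOpposite.unop x) (E.lact γ (MulOpposite.unop z)) = η at *
      rw [hE.left.r_lact _ _ h1] at h2
      have h6 : E.s (MulOpposite.unop z) = ℋ.r (ℋ.inv η) := by
        rw [hℋ.r_inv, h4, hE.s_lact h1]
      rw [← hE.right.ract_ract_inv hℋ h3.symm, h5, hE.commute _ _ _ h1 h6,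
        hE.left.lact_inv_lact h𝒢 (by rw [hE.r_ract h6, h1])]
    · refine (hE.rightBracket_eq hℋ ?_ ?_).symm
      · rw [hℋ.r_mul _ _ (by rw [hE.s_rightBracket hℋ h, k]), hE.r_rightBracket hℋ h]
      · rw [hE.right.ract_mul _ _ _ (hE.r_rightBracket hℋ h).symm
          (by rw [hE.s_rightBracket hℋ h, k]), hE.ract_rightBracket hℋ h]
    · refine (hE.commute _ _ _ ?_ ?_).symm
      · rw [h𝒢.s_inv, k]
      · rw [hℋ.r_inv, h]
    · have h1 : E.s (MulOpposite.unop y) = ℋ.r (ℋ.inv x) := by rw [hℋ.r_inv, h]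
      refine hE.rightBracket_eq hℋ ?_ ?_
      · rw [hE.right.s_ract _ _ h1, hℋ.s_inv, hℋ.r_mul _ _ (by rw [hE.r_rightBracket hℋ k, h])]
      · rw [hE.right.ract_mul _ _ _ (by rw [hE.right.s_ract _ _ h1, hℋ.s_inv])
          (by rw [hE.r_rightBracket hℋ k, h]), hE.right.ract_inv_ract hℋ h.symm,
          hE.ract_rightBracket hℋ k]
    · rw [hℋ.mul_inv_rev h, hE.right.ract_mul _ _ _ (by rw [hℋ.r_inv, k])
        (by rw [hℋ.s_inv, hℋ.r_inv, h])]
    · exact hℋ.mul_assoc _ _ _ h k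
  unit_mul := by
    rintro ((x | x) | (x | x)) <;>
      simp [linking, linkingMul, BiactionStr.op, h𝒢.unit_mul, hℋ.unit_mul, hE.left.unit_lact,
        hℋ.inv_unit, hE.right.ract_unit]
  mul_unit := by
    rintro ((x | x) | (x | x)) <;>
      simp [linking, linkingMul, BiactionStr.op, h𝒢.mul_unit, hℋ.mul_unit, hE.left.unit_lact,
        h𝒢.inv_unit, hE.right.ract_unit]
  r_inv := by
    rintro ((x | x) | (x | x)) <;> simp [linking, BiactionStr.op, h𝒢.r_inv, hℋ.r_inv]
  s_inv := by
    rintro ((x | x) | (x | x)) <;> simp [linking, BiactionStr.op, h𝒢.s_inv, hℋ.s_inv]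
  mul_inv := by
    rintro ((x | x) | (x | x)) <;>
      simp only [linking, linkingMul, BiactionStr.op, h𝒢.mul_inv, hℋ.mul_inv, MulOpposite.unop_op]
    · rw [hE.leftBracket_eq h𝒢 (h𝒢.s_unit _) (hE.left.unit_lact x)]
    · rw [hE.rightBracket_eq hℋ (hℋ.r_unit _).symm (hE.right.ract_unit x.unop)]
  inv_mul := by
    rintro ((x | x) | (x | x)) <;>
      simp only [linking, linkingMul, BiactionStr.op, h𝒢.inv_mul, hℋ.inv_mul, MulOpposite.unop_op]
    · rw [hE.rightBracket_eq hℋ (hℋ.r_unit _).symm (hE.right.ract_unit x)]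
    · rw [hE.leftBracket_eq h𝒢 (h𝒢.s_unit _) (hE.left.unit_lact x.unop)]

end IsEquivalence

end Equivalence

/-! ### The topology of the linking groupoid -/

instance locallyCompactSpace_mulOpposite {X : Type u₁} [TopologicalSpace X]
    [LocallyCompactSpace X] : LocallyCompactSpace Xᵐᵒᵖ :=
  MulOpposite.opHomeomorph.symm.isClosedEmbedding.locallyCompactSpace

instance secondCountableTopology_mulOpposite {X : Type u₁} [TopologicalSpace X]
    [SecondCountableTopology X] : SecondCountableTopology Xᵐᵒᵖ :=
  MulOpposite.opHomeomorph.symm.isInducing.secondCountableTopology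

instance locallyCompactSpace_sum {X : Type u₁} {Y : Type u₂} [TopologicalSpace X]
    [TopologicalSpace Y] [LocallyCompactSpace X] [LocallyCompactSpace Y] :
    LocallyCompactSpace (X ⊕ Y) := by
  refine ⟨?_⟩
  rintro (x | y) n hn
  · rw [nhds_inl] at hn
    obtain ⟨K, hK, hKn, hKc⟩ := local_compact_nhds (Filter.mem_map.1 hn)
    refine ⟨Sum.inl '' K, ?_, Set.image_subset_iff.2 hKn, hKc.image continuous_inl⟩
    rw [nhds_inl]
    exact Filter.image_mem_map hK
  · rw [nhds_inr] at hn
    obtain ⟨K, hK, hKn, hKc⟩ := local_compact_nhds (Filter.mem_map.1 hn)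
    refine ⟨Sum.inr '' K, ?_, Set.image_subset_iff.2 hKn, hKc.image continuous_inr⟩
    rw [nhds_inr]
    exact Filter.image_mem_map hK

/-- Open embeddings preserve relative neighbourhood filters. As the four pieces of `L` are open,
continuity of the product can thus be tested on pairs of pieces. -/
theorem continuousWithinAt_of_comp_prodMap {A : Type u₁} {B : Type u₂} {X : Type u₃}
    {Y : Type u₄} {W : Type u₅} [TopologicalSpace A] [TopologicalSpace B] [TopologicalSpace X]
    [TopologicalSpace Y] [TopologicalSpace W] {i : A → X} {j : B → Y} (hi : IsOpenEmbedding i)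
    (hj : IsOpenEmbedding j) {f : X × Y → W} {S : Set (X × Y)} {a : A} {b : B}
    (hS : (i a, j b) ∈ S) (h : ContinuousOn (fun p : A × B => f (i p.1, j p.2))
      {p | (i p.1, j p.2) ∈ S}) : ContinuousWithinAt f S (i a, j b) := by
  have h1 := (hi.prodMap hj).map_nhdsWithin_preimage_eq S (a, b)
  rw [ContinuousWithinAt, show ((i a, j b) : X × Y) = Prod.map i j (a, b) from rfl, ← h1,
    Filter.tendsto_map'_iff]
  exact h (a, b) hS

section Linking

variable {G₀ : Type u₁} {G : Type u₂} {H₀ : Type u₃} {H : Type u₄} {Z : Type u₅}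
  [TopologicalSpace G₀] [TopologicalSpace G] [TopologicalSpace H₀] [TopologicalSpace H]
  [TopologicalSpace Z]
  {𝒢 : GroupoidStr G₀ G} {ℋ : GroupoidStr H₀ H} {E : BiactionStr G₀ G H₀ H Z}

theorem isOpenEmbedding_ofG : IsOpenEmbedding (ofG : G → LinkingSpace G Z H) :=
  IsOpenEmbedding.inl.comp IsOpenEmbedding.inl

theorem isOpenEmbedding_ofZ : IsOpenEmbedding (ofZ : Z → LinkingSpace G Z H) :=
  IsOpenEmbedding.inl.comp IsOpenEmbedding.inr

theorem isOpenEmbedding_ofZop : IsOpenEmbedding (ofZop : Zᵐᵒᵖ → LinkingSpace G Z H) :=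
  IsOpenEmbedding.inr.comp IsOpenEmbedding.inl

theorem isOpenEmbedding_ofH : IsOpenEmbedding (ofH : H → LinkingSpace G Z H) :=
  IsOpenEmbedding.inr.comp IsOpenEmbedding.inr

theorem IsEquivalence.continuousOn_linkingMul (hE : IsEquivalence 𝒢 ℋ E)
    (h𝒢 : 𝒢.IsLocallyCompactGroupoid) (hℋ : ℋ.IsLocallyCompactGroupoid) :
    ContinuousOn (fun p : LinkingSpace G Z H × LinkingSpace G Z H => linkingMul 𝒢 ℋ E p.1 p.2)
      {p | (linking 𝒢 ℋ E).s p.1 = (linking 𝒢 ℋ E).r p.2} := by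
  have hu := MulOpposite.continuous_unop (M := Z)
  have hR := (hE.rightPrincipal hℋ.toIsGroupoid).right
  have hL := (hE.rightPrincipal_op h𝒢).right
  rintro ⟨(x | x) | (x | x), (y | y) | (y | y)⟩ h <;>
    simp only [linking, Set.mem_ofPred_eq, Sum.inl.injEq, Sum.inr.injEq, reduceCtorEq] at h
  · refine continuousWithinAt_of_comp_prodMap isOpenEmbedding_ofG isOpenEmbedding_ofG
      (congrArg Sum.inl h) ?_
    refine isOpenEmbedding_ofG.continuous.comp_continuousOn (h𝒢.continuousOn_mul.mono ?_)
    exact fun p hp => Sum.inl_injective hp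
  · refine continuousWithinAt_of_comp_prodMap isOpenEmbedding_ofG isOpenEmbedding_ofZ
      (congrArg Sum.inl h) ?_
    refine isOpenEmbedding_ofZ.continuous.comp_continuousOn (hE.left.continuousOn_lact.mono ?_)
    exact fun p hp => Sum.inl_injective hp
  · refine continuousWithinAt_of_comp_prodMap isOpenEmbedding_ofZ isOpenEmbedding_ofZop
      (congrArg Sum.inr h) ?_
    refine isOpenEmbedding_ofG.continuous.comp_continuousOn
      ((hE.continuousOn_leftBracket h𝒢.toIsGroupoid).comp
        (f := fun p : Z × Zᵐᵒᵖ => (p.1, p.2.unop)) (by fun_prop) ?_)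
    exact fun p hp => Sum.inr_injective hp
  · refine continuousWithinAt_of_comp_prodMap isOpenEmbedding_ofZ isOpenEmbedding_ofH
      (congrArg Sum.inr h) ?_
    refine isOpenEmbedding_ofZ.continuous.comp_continuousOn (hR.continuousOn_ract.mono ?_)
    exact fun p hp => Sum.inr_injective hp
  · refine continuousWithinAt_of_comp_prodMap isOpenEmbedding_ofZop isOpenEmbedding_ofG
      (congrArg Sum.inl h) ?_
    refine isOpenEmbedding_ofZop.continuous.comp_continuousOn (hL.continuousOn_ract.mono ?_)
    exact fun p hp => Sum.inl_injective hp
  · refine continuousWithinAt_of_comp_prodMap isOpenEmbedding_ofZop isOpenEmbedding_ofZ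
      (congrArg Sum.inl h) ?_
    refine isOpenEmbedding_ofH.continuous.comp_continuousOn
      ((hE.continuousOn_rightBracket hℋ.toIsGroupoid).comp
        (f := fun p : Zᵐᵒᵖ × Z => (p.1.unop, p.2)) (by fun_prop) ?_)
    exact fun p hp => Sum.inl_injective hp
  · refine continuousWithinAt_of_comp_prodMap isOpenEmbedding_ofH isOpenEmbedding_ofZop
      (congrArg Sum.inr h) ?_
    refine (isOpenEmbedding_ofZop.continuous.comp MulOpposite.continuous_op).comp_continuousOn
      (hR.continuousOn_ract.comp (f := fun p : H × Zᵐᵒᵖ => (p.2.unop, ℋ.inv p.1)) ?_ ?_)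
    · have := hℋ.continuous_inv
      fun_prop
    · exact fun p hp => (Sum.inr_injective hp).symm.trans (hℋ.r_inv _).symm
  · refine continuousWithinAt_of_comp_prodMap isOpenEmbedding_ofH isOpenEmbedding_ofH
      (congrArg Sum.inr h) ?_
    refine isOpenEmbedding_ofH.continuous.comp_continuousOn (hℋ.continuousOn_mul.mono ?_)
    exact fun p hp => Sum.inr_injective hp

theorem IsEquivalence.linking_isLocallyCompactGroupoid (hE : IsEquivalence 𝒢 ℋ E)
    (h𝒢 : 𝒢.IsLocallyCompactGroupoid) (hℋ : ℋ.IsLocallyCompactGroupoid) :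
    (linking 𝒢 ℋ E).IsLocallyCompactGroupoid where
  toIsGroupoid := hE.linking_isGroupoid h𝒢.toIsGroupoid hℋ.toIsGroupoid
  t2 := by
    have := h𝒢.t2
    have := hℋ.t2
    have := hE.t2
    infer_instance
  locallyCompact := by
    have := h𝒢.locallyCompact
    have := hℋ.locallyCompact
    have := hE.locallyCompact
    infer_instance
  secondCountable := by
    have := h𝒢.secondCountable
    have := hℋ.secondCountable
    have := hE.secondCountable
    infer_instance
  continuous_r := by
    refine continuous_sum_dom.2 ⟨continuous_sum_dom.2 ⟨?_, ?_⟩, continuous_sum_dom.2 ⟨?_, ?_⟩⟩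
    · exact continuous_inl.comp h𝒢.continuous_r
    · exact continuous_inl.comp hE.left.continuous_r
    · exact continuous_inr.comp (hE.right.continuous_s.comp MulOpposite.continuous_unop)
    · exact continuous_inr.comp hℋ.continuous_r
  continuous_s := by
    refine continuous_sum_dom.2 ⟨continuous_sum_dom.2 ⟨?_, ?_⟩, continuous_sum_dom.2 ⟨?_, ?_⟩⟩
    · exact continuous_inl.comp h𝒢.continuous_s
    · exact continuous_inr.comp hE.right.continuous_s
    · exact continuous_inl.comp (hE.left.continuous_r.comp MulOpposite.continuous_unop)
    · exact continuous_inr.comp hℋ.continuous_s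
  continuous_unit := by
    refine continuous_sum_dom.2 ⟨?_, ?_⟩
    · exact isOpenEmbedding_ofG.continuous.comp h𝒢.continuous_unit
    · exact isOpenEmbedding_ofH.continuous.comp hℋ.continuous_unit
  continuous_inv := by
    refine continuous_sum_dom.2 ⟨continuous_sum_dom.2 ⟨?_, ?_⟩, continuous_sum_dom.2 ⟨?_, ?_⟩⟩
    · exact isOpenEmbedding_ofG.continuous.comp h𝒢.continuous_inv
    · exact isOpenEmbedding_ofZop.continuous.comp MulOpposite.continuous_op
    · exact isOpenEmbedding_ofZ.continuous.comp MulOpposite.continuous_unop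
    · exact isOpenEmbedding_ofH.continuous.comp hℋ.continuous_inv
  continuousOn_mul := hE.continuousOn_linkingMul h𝒢 hℋ

end Linking

/-! ### Radon measures -/

/-- A compactly supported real function, as a complex one. -/
def complexify {X : Type u₁} [TopologicalSpace X] (f : C_c(X, ℝ)) : C_c(X, ℂ) where
  toFun x := f x
  continuous_toFun := Complex.continuous_ofReal.comp f.continuous
  hasCompactSupport' := f.hasCompactSupport.comp_left (g := Complex.ofReal) Complex.ofReal_zero

theorem integral_complexify {X : Type u₁} [TopologicalSpace X] [MeasurableSpace X] (f : C_c(X, ℝ)) (μ : Measure X) :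
    ∫ x, complexify f x ∂μ = ((∫ x, f x ∂μ : ℝ) : ℂ) :=
  integral_ofReal

theorem integral_map_compactlySupported {X : Type u₁} {Y : Type u₂} [TopologicalSpace Y]
    [MeasurableSpace X] [MeasurableSpace Y] [BorelSpace Y] [SecondCountableTopology Y]
    {μ : Measure X} {f : X → Y} (hf : AEMeasurable f μ) (φ : C_c(Y, ℂ)) :
    ∫ y, φ y ∂μ.map f = ∫ x, φ (f x) ∂μ :=
  integral_map hf φ.continuous.aestronglyMeasurable

section Radon

variable {X : Type u₁} {Y : Type u₂} [TopologicalSpace X] [TopologicalSpace Y]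
  [MeasurableSpace X] [BorelSpace X] [MeasurableSpace Y] [BorelSpace Y]

/-- Real test functions are particular complex ones, so uniqueness of Radon measures with given
integrals applies. -/
theorem measure_ext_of_integral_eq [T2Space X] [LocallyCompactSpace X] {μ ν : Measure X}
    [μ.Regular] [ν.Regular] (h : ∀ f : C_c(X, ℂ), ∫ x, f x ∂μ = ∫ x, f x ∂ν) : μ = ν := by
  refine Measure.ext_of_integral_eq_on_compactlySupported fun f => ?_
  have := h (complexify f)
  rw [integral_complexify, integral_complexify] at this
  exact_mod_cast this

/-- Products and actions are total functions with arbitrary values off the composable pairs. They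
are continuous only on a closed fibre, but that fibre carries the measure. -/
theorem aemeasurable_of_continuousOn {μ : Measure X} {C : Set X} {f : X → Y} (hC : IsClosed C)
    (hμ : ∀ᵐ x ∂μ, x ∈ C) (hf : ContinuousOn f C) : AEMeasurable f μ := by
  rw [← Measure.restrict_eq_self_of_ae_mem hμ]
  exact hf.aemeasurable hC.measurableSet

/-- Such a space is metrizable, and there finiteness on compact sets already forces regularity. -/
theorem regular_of_isFiniteMeasureOnCompacts [T2Space X] [LocallyCompactSpace X]
    [SecondCountableTopology X] {μ : Measure X} (h : ∀ K, IsCompact K → μ K < ⊤) :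
    μ.Regular := by
  have : IsFiniteMeasureOnCompacts μ := ⟨fun K hK => h K hK⟩
  have := TopologicalSpace.metrizableSpace_of_t3_secondCountable X
  infer_instance

theorem regular_map [T2Space Y] [LocallyCompactSpace Y] [SecondCountableTopology Y]
    {μ : Measure X} [μ.Regular] {C : Set X} {f : X → Y} (hC : IsClosed C)
    (hμ : ∀ᵐ x ∂μ, x ∈ C) (hf : ContinuousOn f C)
    (h : ∀ K, IsCompact K → IsCompact (C ∩ f ⁻¹' K)) : (μ.map f).Regular := by
  refine regular_of_isFiniteMeasureOnCompacts fun K hK => ?_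
  rw [Measure.map_apply_of_aemeasurable (aemeasurable_of_continuousOn hC hμ hf) hK.measurableSet]
  have : μ (f ⁻¹' K) = μ (C ∩ f ⁻¹' K) := by
    refine measure_congr ?_
    filter_upwards [hμ] with x hx
    exact propext ⟨fun h => ⟨hx, h⟩, fun h => h.2⟩
  rw [this]
  exact (h K hK).measure_lt_top

/-- A neighbourhood of `f x` pulls back to a set containing `V ∩ C` for some neighbourhood `V` of
`x`; as `C` is conull, its measure is at least `μ V > 0`. -/
theorem mem_support_map {μ : Measure X} {C : Set X} {f : X → Y} (hC : IsClosed C)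
    (hμ : ∀ᵐ x ∂μ, x ∈ C) (hf : ContinuousOn f C) {x : X} (hx : x ∈ C) (hxμ : x ∈ μ.support) :
    f x ∈ (μ.map f).support := by
  rw [Measure.mem_support_iff_forall] at hxμ ⊢
  intro U hU
  have h1 := hf x hx hU
  obtain ⟨V, hV, hVU⟩ := mem_nhdsWithin_iff_exists_mem_nhds_inter.1 h1
  refine lt_of_lt_of_le (hxμ V hV) (le_trans ?_
    (Measure.le_map_apply (aemeasurable_of_continuousOn hC hμ hf) U))
  refine measure_mono_ae ?_
  filter_upwards [hμ] with y hy hyV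
  exact hVU ⟨hyV, hy⟩

end Radon

/-! ### Haar systems -/

section Haar

variable {G₀ : Type u₁} {G : Type u₂} [TopologicalSpace G₀] [TopologicalSpace G]
  {𝒢 : GroupoidStr G₀ G}

theorem GroupoidStr.IsLocallyCompactGroupoid.isClosed_rFiber (h : 𝒢.IsLocallyCompactGroupoid)
    (u : G₀) : IsClosed {x | u = 𝒢.r x} := by
  have := h.t2_unitSpace
  exact isClosed_eq continuous_const h.continuous_r

theorem GroupoidStr.IsLocallyCompactGroupoid.continuousOn_mul_left
    (h : 𝒢.IsLocallyCompactGroupoid) (x : G) :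
    ContinuousOn (𝒢.mul x) {y | 𝒢.s x = 𝒢.r y} :=
  h.continuousOn_mul.comp (f := fun y => (x, y)) (by fun_prop) fun _ hy => hy

variable [MeasurableSpace G] {lam : G₀ → Measure G}

theorem GroupoidStr.IsLocallyCompactGroupoid.ae_r_eq (h : 𝒢.IsLocallyCompactGroupoid)
    {μ : Measure G} {u : G₀} (hμ : μ.support = {x | 𝒢.r x = u}) : ∀ᵐ x ∂μ, u = 𝒢.r x := by
  have := h.secondCountable
  have h1 : μ.support ∈ ae μ := Measure.support_mem_ae
  rw [hμ] at h1
  filter_upwards [h1] with x hx using Eq.symm hx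

theorem GroupoidStr.IsHaarSystem.ae_r_eq (h : 𝒢.IsHaarSystem lam)
    (h𝒢 : 𝒢.IsLocallyCompactGroupoid) (u : G₀) : ∀ᵐ x ∂lam u, u = 𝒢.r x :=
  h𝒢.ae_r_eq (h.support_eq u)

theorem GroupoidStr.IsHaarSystem.continuous_integral_real (h : 𝒢.IsHaarSystem lam)
    (f : C_c(G, ℝ)) : Continuous fun u => ∫ x, f x ∂lam u := by
  have := Complex.continuous_re.comp (h.continuous_integral (complexify f))
  simpa [Function.comp_def, integral_complexify] using this

variable [BorelSpace G]

theorem GroupoidStr.IsHaarSystem.aemeasurable_mul (h : 𝒢.IsHaarSystem lam)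
    (h𝒢 : 𝒢.IsLocallyCompactGroupoid) (x : G) : AEMeasurable (𝒢.mul x) (lam (𝒢.s x)) :=
  aemeasurable_of_continuousOn (h𝒢.isClosed_rFiber _) (h.ae_r_eq h𝒢 _)
    (h𝒢.continuousOn_mul_left x)

/-- Invariance of integrals becomes an equality of measures, which can be composed with further
pushforwards. Uniqueness requires the image measure to be Radon first. -/
theorem GroupoidStr.IsHaarSystem.map_mul (h : 𝒢.IsHaarSystem lam)
    (h𝒢 : 𝒢.IsLocallyCompactGroupoid) (x : G) :
    (lam (𝒢.s x)).map (𝒢.mul x) = lam (𝒢.r x) := by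
  have := h𝒢.t2
  have := h𝒢.locallyCompact
  have := h𝒢.secondCountable
  have := h.regular
  have : ((lam (𝒢.s x)).map (𝒢.mul x)).Regular := by
    refine regular_map (h𝒢.isClosed_rFiber _) (h.ae_r_eq h𝒢 _)
      (h𝒢.continuousOn_mul_left x) fun K hK => ?_
    -- The preimage of `K` in the fibre is the image of `K ∩ r⁻¹(r x)` under multiplication by
    -- `x⁻¹`, hence compact.
    convert (hK.inter_right (h𝒢.isClosed_rFiber (𝒢.r x))).image_of_continuousOn
      (f := 𝒢.mul (𝒢.inv x)) ((h𝒢.continuousOn_mul_left _).mono ?_) using 1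
    · ext y
      constructor
      · rintro ⟨hy, hyK⟩
        exact ⟨𝒢.mul x y, ⟨hyK, (h𝒢.r_mul _ _ hy).symm⟩, h𝒢.inv_mul_cancel_left hy⟩
      · rintro ⟨y, ⟨hyK, hy⟩, rfl⟩
        refine ⟨?_, ?_⟩
        · exact ((h𝒢.r_mul _ _ ((h𝒢.s_inv x).trans hy)).trans (h𝒢.r_inv x)).symm
        · rwa [Set.mem_preimage, h𝒢.mul_inv_cancel_left hy]
    · exact fun y hy => (h𝒢.s_inv x).trans hy.2
  refine measure_ext_of_integral_eq fun f => ?_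
  rw [integral_map_compactlySupported (h.aemeasurable_mul h𝒢 x),
    h.left_invariant f x]

end Haar

/-! ### Measures on the fibres of a principal space -/

namespace IsRightPrincipal

variable {G₀ : Type u₁} {G : Type u₂} {H₀ : Type u₃} {H : Type u₄} {Z : Type u₅}
  [TopologicalSpace G₀] [TopologicalSpace H₀] [TopologicalSpace H] [TopologicalSpace Z]
  {ℋ : GroupoidStr H₀ H} {E : BiactionStr G₀ G H₀ H Z}

theorem continuousOn_ract_left (hE : IsRightPrincipal ℋ E) (z : Z) :
    ContinuousOn (E.ract z) {η | E.s z = ℋ.r η} :=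
  hE.right.continuousOn_ract.comp (f := fun η => (z, η)) (by fun_prop) fun _ hη => hη

/-- This is the projection to `H` of the preimage of `K × N` under the proper map `(z, η) ↦ (z • η,
z)`. -/
theorem isCompact_translators (hE : IsRightPrincipal ℋ E) {N K : Set Z} (hN : IsCompact N)
    (hK : IsCompact K) : IsCompact {η | ∃ z ∈ N, E.s z = ℋ.r η ∧ E.ract z η ∈ K} := by
  have h1 := (hE.right.proper.isCompact_preimage (hK.prod hN)).image
    (continuous_snd.comp continuous_subtype_val)
  convert h1 using 1
  ext η
  constructor
  · rintro ⟨z, hz, h, hzK⟩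
    exact ⟨⟨(z, η), h⟩, ⟨hzK, hz⟩, rfl⟩
  · rintro ⟨⟨⟨z, η⟩, h⟩, ⟨hzK, hz⟩, rfl⟩
    exact ⟨z, hz, h, hzK⟩

theorem isCompact_fiber_inter_preimage (hE : IsRightPrincipal ℋ E) (z : Z) {K : Set Z}
    (hK : IsCompact K) : IsCompact ({η | E.s z = ℋ.r η} ∩ E.ract z ⁻¹' K) := by
  convert hE.isCompact_translators (isCompact_singleton (x := z)) hK using 1
  ext η
  simp

/-- A compactly supported function on `Z`, composed with an orbit map, agrees on the fibre with a
compactly supported function on `H`. -/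
theorem exists_extension_comp_ract (hE : IsRightPrincipal ℋ E)
    (hℋ : ℋ.IsLocallyCompactGroupoid) (φ : C_c(Z, ℂ)) (z : Z) :
    ∃ F : C_c(H, ℂ), ∀ η, E.s z = ℋ.r η → F η = φ (E.ract z η) := by
  have := hℋ.t2
  have := hℋ.locallyCompact
  have := hℋ.secondCountable
  have hcl := hℋ.isClosed_rFiber (E.s z)
  have := TopologicalSpace.metrizableSpace_of_t3_secondCountable H
  obtain ⟨g, hg⟩ := ContinuousMap.exists_restrict_eq hcl
    (⟨fun η => φ (E.ract z η), φ.continuous.comp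
      (continuousOn_iff_continuous_domRestrict.1 (hE.continuousOn_ract_left z))⟩ :
      C({η | E.s z = ℋ.r η}, ℂ))
  -- The Tietze extension `g` need not have compact support. The cutoff `χ` is `1` wherever `φ (z •
  -- η)` can be nonzero on the fibre, so `χ g` still has the right values there.
  obtain ⟨χ, hχ1, -, hχc, -⟩ := exists_continuous_one_zero_of_isCompact
    (hE.isCompact_fiber_inter_preimage z φ.hasCompactSupport) isClosed_empty
    (Set.disjoint_empty _)
  refine ⟨⟨⟨fun η => (χ η : ℂ) * g η, by fun_prop⟩, ?_⟩, fun η hη => ?_⟩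
  · exact (hχc.comp_left (g := Complex.ofReal) Complex.ofReal_zero).mul_right
  · have h1 : g η = φ (E.ract z η) := congrArg (fun k => k ⟨η, hη⟩) hg
    change (χ η : ℂ) * g η = _
    rw [h1]
    by_cases h2 : E.ract z η ∈ tsupport φ
    · rw [hχ1 ⟨hη, h2⟩]
      simp
    · rw [image_eq_zero_of_notMem_tsupport h2, mul_zero]

/-- For `z` in a compact neighbourhood `N` of `z₀`, both functions of `η` vanish outside one compact
`K`, and `χ = 1` on `K`. The pairs in `N × K` with error at least `ε` form a compact set, whose
projection to `Z` is closed and misses `z₀`. That `χ` does not depend on `ε` is essential when the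
bound is integrated. -/
theorem eventually_norm_comp_ract_sub_le [T2Space Z] [LocallyCompactSpace Z]
    (hE : IsRightPrincipal ℋ E)
    (hℋ : ℋ.IsLocallyCompactGroupoid) (φ : C_c(Z, ℂ)) (F : C_c(H, ℂ)) (z₀ : Z)
    (hF : ∀ η, E.s z₀ = ℋ.r η → F η = φ (E.ract z₀ η)) :
    ∃ χ : C_c(H, ℝ), ∀ ε > 0, ∀ᶠ z in 𝓝 z₀, ∀ η, E.s z = ℋ.r η →
      ‖φ (E.ract z η) - F η‖ ≤ ε * χ η := by
  have := hℋ.t2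
  have := hℋ.locallyCompact
  have := hℋ.t2_unitSpace
  obtain ⟨N, hNc, hN⟩ := exists_compact_mem_nhds z₀
  have hK := (hE.isCompact_translators hNc φ.hasCompactSupport).union F.hasCompactSupport
  obtain ⟨χ, hχ1, -, hχc, hχ⟩ := exists_continuous_one_zero_of_isCompact hK isClosed_empty
    (Set.disjoint_empty _)
  refine ⟨⟨χ, hχc⟩, fun ε hε => ?_⟩
  set K := {η | ∃ z ∈ N, E.s z = ℋ.r η ∧ E.ract z η ∈ tsupport φ} ∪ tsupport F
  have hScl : IsClosed {p : Z × H | E.s p.1 = ℋ.r p.2} :=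
    isClosed_eq (hE.right.continuous_s.comp continuous_fst)
      (hℋ.continuous_r.comp continuous_snd)
  have hD : ContinuousOn (fun p : Z × H => ‖φ (E.ract p.1 p.2) - F p.2‖)
      {p | E.s p.1 = ℋ.r p.2} :=
    ((φ.continuous.comp_continuousOn hE.right.continuousOn_ract).sub
      (F.continuous.comp continuous_snd).continuousOn).norm
  have hB := (hNc.prod hK).inter_right
    (hD.preimage_isClosed_of_isClosed hScl (isClosed_Ici (a := ε)))
  have hBcl := (hB.image continuous_fst).isClosed
  have hz₀ : z₀ ∈ (Prod.fst '' (N ×ˢ K ∩ ({p : Z × H | E.s p.1 = ℋ.r p.2} ∩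
      (fun p : Z × H => ‖φ (E.ract p.1 p.2) - F p.2‖) ⁻¹' Set.Ici ε)))ᶜ := by
    rintro ⟨⟨z, η⟩, ⟨-, hzη, h⟩, rfl⟩
    simp only [Set.mem_preimage, Set.mem_Ici] at h
    rw [hF η hzη, sub_self, norm_zero] at h
    exact absurd h (not_le.2 hε)
  filter_upwards [hN, hBcl.isOpen_compl.mem_nhds hz₀] with z hzN hz η hη
  by_cases hηK : η ∈ K
  · have h1 : χ η = 1 := hχ1 hηK
    change _ ≤ ε * χ η
    rw [h1, mul_one]
    by_contra h
    exact hz ⟨(z, η), ⟨⟨hzN, hηK⟩, hη, (not_le.1 h).le⟩, rfl⟩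
  · have h1 : φ (E.ract z η) = 0 :=
      image_eq_zero_of_notMem_tsupport fun h => hηK (Or.inl ⟨z, hzN, hη, h⟩)
    have h2 : F η = 0 := image_eq_zero_of_notMem_tsupport fun h => hηK (Or.inr h)
    rw [h1, h2, sub_self, norm_zero]
    exact mul_nonneg hε.le (hχ η).1

variable [MeasurableSpace H] [BorelSpace H] [MeasurableSpace Z] [BorelSpace Z]
  {β : H₀ → Measure H}

theorem aemeasurable_ract (hE : IsRightPrincipal ℋ E) (hℋ : ℋ.IsLocallyCompactGroupoid)
    (hβ : ℋ.IsHaarSystem β) (z : Z) : AEMeasurable (E.ract z) (β (E.s z)) :=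
  aemeasurable_of_continuousOn (hℋ.isClosed_rFiber _) (hβ.ae_r_eq hℋ _)
    (hE.continuousOn_ract_left z)

/-- With `w = z • η`, the orbit map of `w` is `ζ ↦ z • (η ζ)`, and left multiplication by `η`
carries `β (s η)` to `β (r η)`. -/
theorem map_ract_eq (hE : IsRightPrincipal ℋ E) (hℋ : ℋ.IsLocallyCompactGroupoid)
    (hβ : ℋ.IsHaarSystem β) {z w : Z} (hzw : E.r z = E.r w) :
    (β (E.s z)).map (E.ract z) = (β (E.s w)).map (E.ract w) := by
  obtain ⟨η, h1, rfl⟩ := hE.exists_ract z w hzw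
  have h2 := hE.right.s_ract _ _ h1
  have h3 := hE.aemeasurable_ract hℋ hβ z
  rw [h1, ← hβ.map_mul hℋ η] at h3
  rw [h2, h1, ← hβ.map_mul hℋ η,
    AEMeasurable.map_map_of_aemeasurable h3 (hβ.aemeasurable_mul hℋ η)]
  refine Measure.map_congr ?_
  filter_upwards [hβ.ae_r_eq hℋ (ℋ.s η)] with ζ hζ
  exact hE.right.ract_mul _ _ _ h1 hζ

variable [T2Space Z] [LocallyCompactSpace Z] [SecondCountableTopology Z]

theorem regular_map_ract (hE : IsRightPrincipal ℋ E) (hℋ : ℋ.IsLocallyCompactGroupoid)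
    (hβ : ℋ.IsHaarSystem β) (z : Z) : ((β (E.s z)).map (E.ract z)).Regular := by
  have := hβ.regular
  exact regular_map (hℋ.isClosed_rFiber _) (hβ.ae_r_eq hℋ _) (hE.continuousOn_ract_left z)
    fun K hK => hE.isCompact_fiber_inter_preimage z hK

/-- A base point is chosen in each fibre of `r`; `map_ract_eq` removes the dependence on the choice.
-/
theorem exists_orbitSystem (hE : IsRightPrincipal ℋ E) (hℋ : ℋ.IsLocallyCompactGroupoid)
    (hβ : ℋ.IsHaarSystem β) : ∃ σ, IsOrbitSystem E β σ := by
  let z := Function.surjInv hE.surjective_r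
  refine ⟨fun u => (β (E.s (z u))).map (E.ract (z u)), fun u =>
    ⟨hE.regular_map_ract hℋ hβ _, fun w hw φ => ?_⟩⟩
  change ∫ w, φ w ∂(β (E.s (z u))).map (E.ract (z u)) = _
  rw [hE.map_ract_eq hℋ hβ ((Function.surjInv_eq hE.surjective_r u).trans hw.symm),
    integral_map_compactlySupported (hE.aemeasurable_ract hℋ hβ w)]

theorem orbitSystem_eq_map (hE : IsRightPrincipal ℋ E) (hℋ : ℋ.IsLocallyCompactGroupoid)
    (hβ : ℋ.IsHaarSystem β) {σ : G₀ → Measure Z} (hσ : IsOrbitSystem E β σ) (z : Z) :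
    σ (E.r z) = (β (E.s z)).map (E.ract z) := by
  have := hE.regular_map_ract hℋ hβ z
  have := (hσ (E.r z)).1
  refine measure_ext_of_integral_eq fun φ => ?_
  rw [(hσ (E.r z)).2 z rfl φ,
    integral_map_compactlySupported (hE.aemeasurable_ract hℋ hβ z)]

theorem existsUnique_orbitSystem (hE : IsRightPrincipal ℋ E)
    (hℋ : ℋ.IsLocallyCompactGroupoid) (hβ : ℋ.IsHaarSystem β) :
    ∃! σ, IsOrbitSystem E β σ := by
  obtain ⟨σ, hσ⟩ := hE.exists_orbitSystem hℋ hβ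
  refine ⟨σ, hσ, fun σ' hσ' => funext fun u => ?_⟩
  obtain ⟨z, rfl⟩ := hE.surjective_r u
  rw [hE.orbitSystem_eq_map hℋ hβ hσ, hE.orbitSystem_eq_map hℋ hβ hσ']

/-- The measure is concentrated on the closed fibre because orbits stay in fibres. Conversely, the
unit at `s z` lies in the support of `β (s z)` and the orbit map sends it to `z`. -/
theorem support_orbitSystem [T1Space G₀] (hE : IsRightPrincipal ℋ E)
    (hℋ : ℋ.IsLocallyCompactGroupoid) (hβ : ℋ.IsHaarSystem β) {σ : G₀ → Measure Z}
    (hσ : IsOrbitSystem E β σ) (u : G₀) : (σ u).support = {z | E.r z = u} := by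
  have hcl : IsClosed {z | E.r z = u} := isClosed_singleton.preimage hE.continuous_r
  refine Set.Subset.antisymm (Measure.support_subset_of_isClosed hcl ?_) ?_
  · obtain ⟨z, rfl⟩ := hE.surjective_r u
    rw [hE.orbitSystem_eq_map hℋ hβ hσ z]
    refine (ae_map_iff (hE.aemeasurable_ract hℋ hβ z) hcl.measurableSet).2 ?_
    filter_upwards [hβ.ae_r_eq hℋ (E.s z)] with η hη using hE.r_ract z η hη
  · rintro z rfl
    rw [hE.orbitSystem_eq_map hℋ hβ hσ z]
    have h1 : E.s z = ℋ.r (ℋ.unit (E.s z)) := (hℋ.r_unit _).symm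
    have h2 : ℋ.unit (E.s z) ∈ (β (E.s z)).support := by
      rw [hβ.support_eq]
      exact h1.symm
    have := mem_support_map (hℋ.isClosed_rFiber _) (hβ.ae_r_eq hℋ _)
      (hE.continuousOn_ract_left z) h1 h2
    rwa [hE.right.ract_unit] at this

theorem integrable_comp_ract (hE : IsRightPrincipal ℋ E) (hℋ : ℋ.IsLocallyCompactGroupoid)
    (hβ : ℋ.IsHaarSystem β) (φ : C_c(Z, ℂ)) (z : Z) :
    Integrable (fun η => φ (E.ract z η)) (β (E.s z)) := by
  have := hE.regular_map_ract hℋ hβ z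
  exact (integrable_map_measure φ.continuous.aestronglyMeasurable
    (hE.aemeasurable_ract hℋ hβ z)).1
    (φ.continuous.integrable_of_hasCompactSupport φ.hasCompactSupport)

/-- Since `z ↦ ∫ F dβ (s z)` is continuous and agrees with the integral at `z₀`, it suffices that
the difference tends to `0`. It is bounded by `ε ∫ χ dβ (s z)`, and this last integral is bounded
near `z₀`. -/
theorem continuous_integral_comp_ract (hE : IsRightPrincipal ℋ E)
    (hℋ : ℋ.IsLocallyCompactGroupoid) (hβ : ℋ.IsHaarSystem β) (φ : C_c(Z, ℂ)) :
    Continuous fun z => ∫ η, φ (E.ract z η) ∂β (E.s z) := by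
  have := hβ.regular
  refine continuous_iff_continuousAt.2 fun z₀ => ?_
  obtain ⟨F, hF⟩ := hE.exists_extension_comp_ract hℋ φ z₀
  obtain ⟨χ, hχ⟩ := hE.eventually_norm_comp_ract_sub_le hℋ φ F z₀ hF
  have hs := hE.right.continuous_s
  have hm := ((hβ.continuous_integral_real χ).comp hs).tendsto z₀
  have hFc := ((hβ.continuous_integral F).comp hs).tendsto z₀
  have h0 : ∫ η, φ (E.ract z₀ η) ∂β (E.s z₀) = ∫ η, F η ∂β (E.s z₀) := by
    refine integral_congr_ae ?_
    filter_upwards [hβ.ae_r_eq hℋ (E.s z₀)] with η hη using (hF η hη).symm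
  have hFi : ∀ v, Integrable F (β v) := fun v =>
    F.continuous.integrable_of_hasCompactSupport F.hasCompactSupport
  have hχi : ∀ v, Integrable χ (β v) := fun v =>
    χ.continuous.integrable_of_hasCompactSupport χ.hasCompactSupport
  have key : Filter.Tendsto (fun z => ∫ η, φ (E.ract z η) ∂β (E.s z) - ∫ η, F η ∂β (E.s z))
      (𝓝 z₀) (𝓝 0) := by
    set m := ∫ η, χ η ∂β (E.s z₀)
    rw [Metric.tendsto_nhds]
    intro δ hδ
    -- Near `z₀` the integral of `χ` stays below `|m| + 1`; the factor `2` in the choice of `ε`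
    -- leaves a total of `δ / 2`, strictly below `δ`.
    have hpos : 0 < |m| + 1 := by positivity
    have hε : 0 < δ / (2 * (|m| + 1)) := by positivity
    filter_upwards [hχ _ hε, hm.eventually_lt_const (u := |m| + 1)
      (lt_of_le_of_lt (le_abs_self m) (lt_add_one _))] with z hz hmz
    rw [dist_zero_right, ← integral_sub (hE.integrable_comp_ract hℋ hβ φ z) (hFi _)]
    calc ‖∫ η, φ (E.ract z η) - F η ∂β (E.s z)‖
        ≤ ∫ η, δ / (2 * (|m| + 1)) * χ η ∂β (E.s z) := by
          refine norm_integral_le_of_norm_le ((hχi _).const_mul _) ?_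
          filter_upwards [hβ.ae_r_eq hℋ (E.s z)] with η hη using hz η hη
      _ = δ / (2 * (|m| + 1)) * ∫ η, χ η ∂β (E.s z) := integral_const_mul _ _
      _ ≤ δ / (2 * (|m| + 1)) * (|m| + 1) := by gcongr; exact hmz.le
      _ < δ := by field_simp; linarith
  have := key.add hFc
  simp only [Function.comp_apply, sub_add_cancel, zero_add] at this
  rw [ContinuousAt, h0]
  exact this

/-- An open continuous surjection is a quotient map, so continuity may be tested after composing
with `r`, where the integral is explicit. -/
theorem continuous_integral_orbitSystem (hE : IsRightPrincipal ℋ E)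
    (hℋ : ℋ.IsLocallyCompactGroupoid) (hβ : ℋ.IsHaarSystem β) {σ : G₀ → Measure Z}
    (hσ : IsOrbitSystem E β σ) (φ : C_c(Z, ℂ)) : Continuous fun u => ∫ z, φ z ∂σ u := by
  rw [(hE.isOpenMap_r.isQuotientMap hE.continuous_r hE.surjective_r).continuous_iff]
  convert hE.continuous_integral_comp_ract hℋ hβ φ using 1
  ext z
  exact (hσ (E.r z)).2 z rfl φ

end IsRightPrincipal

/-! ### The Haar system of the linking groupoid -/

/-- The pattern of every case of left invariance: `μ` and `ν` are images of one measure `ρ`, and `m`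
carries the first parametrization to the second. -/
theorem map_map_of_parametrization {A B L P : Type*} [MeasurableSpace A] [MeasurableSpace B]
    [MeasurableSpace L] [MeasurableSpace P] {ρ : Measure P} {μ : Measure A} {ν : Measure B}
    {i : A → L} {j : B → L} {m : L → L} {p : P → A} {q : P → B} (hi : Measurable i)
    (hj : Measurable j) (hm : AEMeasurable m (μ.map i)) (hp : AEMeasurable p ρ)
    (hq : AEMeasurable q ρ) (hμ : μ = ρ.map p) (hν : ν = ρ.map q)
    (h : ∀ᵐ a ∂ρ, m (i (p a)) = j (q a)) : (μ.map i).map m = ν.map j := by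
  subst hμ hν
  rw [AEMeasurable.map_map_of_aemeasurable hi.aemeasurable hp] at hm ⊢
  rw [AEMeasurable.map_map_of_aemeasurable hm (hi.comp_aemeasurable hp),
    AEMeasurable.map_map_of_aemeasurable hj.aemeasurable hq]
  exact Measure.map_congr h

section ClosedEmbedding

variable {A B L : Type*} [TopologicalSpace A] [TopologicalSpace B] [TopologicalSpace L]

/-- The composition of a compactly supported function with a closed embedding. -/
def compClosedEmbedding (F : C_c(L, ℂ)) {i : A → L} (hi : IsClosedEmbedding i) : C_c(A, ℂ) where
  toFun a := F (i a)
  continuous_toFun := F.continuous.comp hi.continuous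
  hasCompactSupport' := F.hasCompactSupport.comp_isClosedEmbedding hi

variable [MeasurableSpace A] [BorelSpace A] [MeasurableSpace B] [BorelSpace B]
  [MeasurableSpace L] [BorelSpace L]
  {μ : Measure A} {ν : Measure B} {i : A → L} {j : B → L}

theorem regular_map_add_map [T2Space L] [LocallyCompactSpace L] [SecondCountableTopology L]
    [μ.Regular] [ν.Regular] (hi : IsClosedEmbedding i) (hj : IsClosedEmbedding j) :
    (μ.map i + ν.map j).Regular := by
  refine regular_of_isFiniteMeasureOnCompacts fun K hK => ?_
  rw [Measure.add_apply, Measure.map_apply hi.continuous.measurable hK.measurableSet,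
    Measure.map_apply hj.continuous.measurable hK.measurableSet]
  exact ENNReal.add_lt_top.2
    ⟨(hi.isCompact_preimage hK).measure_lt_top, (hj.isCompact_preimage hK).measure_lt_top⟩

theorem integral_map_add_map [SecondCountableTopology L] [μ.Regular] [ν.Regular]
    (hi : IsClosedEmbedding i) (hj : IsClosedEmbedding j) (F : C_c(L, ℂ)) :
    ∫ l, F l ∂(μ.map i + ν.map j) = ∫ a, F (i a) ∂μ + ∫ b, F (j b) ∂ν := by
  have h1 : Integrable F (μ.map i) := (integrable_map_measure
    F.continuous.aestronglyMeasurable hi.continuous.measurable.aemeasurable).2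
    ((compClosedEmbedding F hi).continuous.integrable_of_hasCompactSupport
      (compClosedEmbedding F hi).hasCompactSupport)
  have h2 : Integrable F (ν.map j) := (integrable_map_measure
    F.continuous.aestronglyMeasurable hj.continuous.measurable.aemeasurable).2
    ((compClosedEmbedding F hj).continuous.integrable_of_hasCompactSupport
      (compClosedEmbedding F hj).hasCompactSupport)
  rw [integral_add_measure h1 h2,
    integral_map_compactlySupported hi.continuous.measurable.aemeasurable,
    integral_map_compactlySupported hj.continuous.measurable.aemeasurable]

theorem support_map_of_isClosedEmbedding [SecondCountableTopology A] (hi : IsClosedEmbedding i) :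
    (μ.map i).support = i '' μ.support := by
  refine Set.Subset.antisymm (Measure.support_subset_of_isClosed
    (hi.isClosedMap _ Measure.isClosed_support) ?_) ?_
  · refine (ae_map_iff hi.continuous.measurable.aemeasurable
      (hi.isClosedMap _ Measure.isClosed_support).measurableSet).2 ?_
    filter_upwards [Measure.support_mem_ae (μ := μ)] with a ha using ⟨a, ha, rfl⟩
  · rintro _ ⟨a, ha, rfl⟩
    exact mem_support_map isClosed_univ (by simp) hi.continuous.continuousOn trivial ha

end ClosedEmbedding

section Linking

variable {G₀ : Type u₁} {G : Type u₂} {H₀ : Type u₃} {H : Type u₄} {Z : Type u₅}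

/-- The measures on `L` assembled from measures on its four pieces. -/
def linkingMeasure [MeasurableSpace G] [MeasurableSpace H] [MeasurableSpace Z]
    (lam : G₀ → Measure G) (β : H₀ → Measure H) (σ : G₀ → Measure Z) (τ : H₀ → Measure Zᵐᵒᵖ) :
    G₀ ⊕ H₀ → Measure (LinkingSpace G Z H)
  | .inl u => (lam u).map ofG + (σ u).map ofZ
  | .inr v => (τ v).map ofZop + (β v).map ofH

variable [TopologicalSpace G] [TopologicalSpace H] [TopologicalSpace Z]

theorem isClosedEmbedding_ofG : IsClosedEmbedding (ofG : G → LinkingSpace G Z H) :=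
  IsClosedEmbedding.inl.comp IsClosedEmbedding.inl

theorem isClosedEmbedding_ofZ : IsClosedEmbedding (ofZ : Z → LinkingSpace G Z H) :=
  IsClosedEmbedding.inl.comp IsClosedEmbedding.inr

theorem isClosedEmbedding_ofZop : IsClosedEmbedding (ofZop : Zᵐᵒᵖ → LinkingSpace G Z H) :=
  IsClosedEmbedding.inr.comp IsClosedEmbedding.inl

theorem isClosedEmbedding_ofH : IsClosedEmbedding (ofH : H → LinkingSpace G Z H) :=
  IsClosedEmbedding.inr.comp IsClosedEmbedding.inr

variable [MeasurableSpace G] [BorelSpace G] [MeasurableSpace H] [BorelSpace H]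
  [MeasurableSpace Z] [BorelSpace Z]
  {lam : G₀ → Measure G} {β : H₀ → Measure H} {σ : G₀ → Measure Z} {τ : H₀ → Measure Zᵐᵒᵖ}

theorem IsLinkingSystem.unique [T2Space G] [T2Space H] [T2Space Z]
    [LocallyCompactSpace G] [LocallyCompactSpace H] [LocallyCompactSpace Z]
    {κ κ' : G₀ ⊕ H₀ → Measure (LinkingSpace G Z H)}
    (h : IsLinkingSystem lam β σ τ κ) (h' : IsLinkingSystem lam β σ τ κ') : κ' = κ := by
  have := h.regular
  have := h'.regular
  funext w
  refine measure_ext_of_integral_eq fun F => ?_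
  rcases w with u | v
  · rw [h.integral_inl, h'.integral_inl]
  · rw [h.integral_inr, h'.integral_inr]

theorem isLinkingSystem_linkingMeasure [T2Space G] [T2Space H] [T2Space Z]
    [LocallyCompactSpace G] [LocallyCompactSpace H] [LocallyCompactSpace Z]
    [SecondCountableTopology G] [SecondCountableTopology H] [SecondCountableTopology Z]
    (hlam : ∀ u, (lam u).Regular) (hβ : ∀ v, (β v).Regular)
    (hσ : ∀ u, (σ u).Regular) (hτ : ∀ v, (τ v).Regular) :
    IsLinkingSystem lam β σ τ (linkingMeasure lam β σ τ) where
  regular := by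
    rintro (u | v)
    · exact regular_map_add_map isClosedEmbedding_ofG isClosedEmbedding_ofZ
    · exact regular_map_add_map isClosedEmbedding_ofZop isClosedEmbedding_ofH
  integral_inl _ F := integral_map_add_map isClosedEmbedding_ofG isClosedEmbedding_ofZ F
  integral_inr _ F := integral_map_add_map isClosedEmbedding_ofZop isClosedEmbedding_ofH F

variable [TopologicalSpace G₀] [TopologicalSpace H₀]
  {𝒢 : GroupoidStr G₀ G} {ℋ : GroupoidStr H₀ H} {E : BiactionStr G₀ G H₀ H Z}
  [T2Space Z] [LocallyCompactSpace Z] [SecondCountableTopology Z]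

/-- Multiplication by `k` sends each of the two pieces carrying `κ (s k)` to one of those carrying
`κ (r k)`. On each piece the claim is an associativity, such as `γ • (z • η) = (γ • z) • η`, a
cancellation, such as `ȳ (y • η) = η`, or the invariance of `lam` or `β`. -/
theorem IsEquivalence.map_linkingMul_linkingMeasure (hE : IsEquivalence 𝒢 ℋ E)
    (h𝒢 : 𝒢.IsLocallyCompactGroupoid) (hℋ : ℋ.IsLocallyCompactGroupoid)
    (hlam : 𝒢.IsHaarSystem lam) (hβ : ℋ.IsHaarSystem β) (hσ : IsOrbitSystem E β σ)
    (hτ : IsOrbitSystem (E.op 𝒢 ℋ) lam τ) {k : LinkingSpace G Z H}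
    (hk : AEMeasurable (linkingMul 𝒢 ℋ E k)
      (linkingMeasure lam β σ τ ((linking 𝒢 ℋ E).s k))) :
    (linkingMeasure lam β σ τ ((linking 𝒢 ℋ E).s k)).map (linkingMul 𝒢 ℋ E k) =
      linkingMeasure lam β σ τ ((linking 𝒢 ℋ E).r k) := by
  have hP := hE.rightPrincipal hℋ.toIsGroupoid
  have hQ := hE.rightPrincipal_op h𝒢
  have mG := (isClosedEmbedding_ofG (G := G) (Z := Z) (H := H)).continuous.measurable
  have mZ := (isClosedEmbedding_ofZ (G := G) (Z := Z) (H := H)).continuous.measurable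
  have mZop := (isClosedEmbedding_ofZop (G := G) (Z := Z) (H := H)).continuous.measurable
  have mH := (isClosedEmbedding_ofH (G := G) (Z := Z) (H := H)).continuous.measurable
  have eσ := hP.orbitSystem_eq_map hℋ hβ hσ
  have eτ := hQ.orbitSystem_eq_map h𝒢 hlam hτ
  have aσ := hP.aemeasurable_ract hℋ hβ
  have aτ := hQ.aemeasurable_ract h𝒢 hlam
  rcases k with (γ | z) | (y | η)
  · change AEMeasurable _ ((lam (𝒢.s γ)).map ofG + (σ (𝒢.s γ)).map ofZ) at hk
    change ((lam (𝒢.s γ)).map ofG + (σ (𝒢.s γ)).map ofZ).map _ =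
      (lam (𝒢.r γ)).map ofG + (σ (𝒢.r γ)).map ofZ
    obtain ⟨hk1, hk2⟩ := aemeasurable_add_measure_iff.1 hk
    -- A base point over `s γ`: the orbit maps of `z` and of `γ • z` parametrize `σ (s γ)` and `σ (r
    -- γ)` by the same measure `β (s z)`.
    obtain ⟨z, hz⟩ := hP.surjective_r (𝒢.s γ)
    have hs := hE.s_lact hz.symm
    have h1 := aσ (E.lact γ z)
    have h2 := eσ (E.lact γ z)
    rw [hs] at h1 h2
    rw [hE.left.r_lact _ _ hz.symm] at h2
    rw [AEMeasurable.map_add₀ hk1 hk2]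
    congr 1
    · refine map_map_of_parametrization mG mG hk1 aemeasurable_id (hlam.aemeasurable_mul h𝒢 γ)
        Measure.map_id.symm (hlam.map_mul h𝒢 γ).symm (ae_of_all _ fun δ => rfl)
    · refine map_map_of_parametrization mZ mZ hk2 (aσ z) h1 (by rw [← hz, eσ]) h2 ?_
      filter_upwards [hβ.ae_r_eq hℋ (E.s z)] with η hη
      exact congrArg ofZ (hE.commute _ _ _ hz.symm hη).symm
  · change AEMeasurable _ ((τ (E.s z)).map ofZop + (β (E.s z)).map ofH) at hk
    change ((τ (E.s z)).map ofZop + (β (E.s z)).map ofH).map _ =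
      (lam (E.r z)).map ofG + (σ (E.r z)).map ofZ
    obtain ⟨hk1, hk2⟩ := aemeasurable_add_measure_iff.1 hk
    rw [AEMeasurable.map_add₀ hk1 hk2]
    congr 1
    -- Since `z (z̄ • γ) = γ`, multiplication by `z` undoes the parametrization of `τ (s z)` by `lam
    -- (r z)`.
    · refine map_map_of_parametrization mZop mG hk1 (aτ (MulOpposite.op z)) aemeasurable_id
        (eτ (MulOpposite.op z)) Measure.map_id.symm ?_
      filter_upwards [hlam.ae_r_eq h𝒢 (E.r z)] with γ hγ
      have h1 : 𝒢.s (𝒢.inv γ) = E.r z := (h𝒢.s_inv γ).trans hγ.symm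
      refine congrArg ofG (hE.leftBracket_eq h𝒢.toIsGroupoid ?_ ?_)
      · exact ((hE.left.r_lact _ _ h1).trans (h𝒢.r_inv γ)).symm
      · exact hE.left.lact_lact_inv h𝒢.toIsGroupoid hγ.symm
    · exact map_map_of_parametrization mH mZ hk2 aemeasurable_id (aσ z) Measure.map_id.symm
        (eσ z) (ae_of_all _ fun η => rfl)
  · change AEMeasurable _ ((lam (E.r y.unop)).map ofG + (σ (E.r y.unop)).map ofZ) at hk
    change ((lam (E.r y.unop)).map ofG + (σ (E.r y.unop)).map ofZ).map _ =
      (τ (E.s y.unop)).map ofZop + (β (E.s y.unop)).map ofH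
    obtain ⟨hk1, hk2⟩ := aemeasurable_add_measure_iff.1 hk
    rw [AEMeasurable.map_add₀ hk1 hk2]
    congr 1
    · exact map_map_of_parametrization mG mZop hk1 aemeasurable_id (aτ y) Measure.map_id.symm
        (eτ y) (ae_of_all _ fun γ => rfl)
    -- Dually, `y` times a point `y.unop • η` of the orbit gives back `η`.
    · refine map_map_of_parametrization mZ mH hk2 (aσ y.unop) aemeasurable_id
        (eσ y.unop) Measure.map_id.symm ?_
      filter_upwards [hβ.ae_r_eq hℋ (E.s y.unop)] with η hη
      exact congrArg ofH (hE.rightBracket_eq hℋ.toIsGroupoid hη rfl)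
  · change AEMeasurable _ ((τ (ℋ.s η)).map ofZop + (β (ℋ.s η)).map ofH) at hk
    change ((τ (ℋ.s η)).map ofZop + (β (ℋ.s η)).map ofH).map _ =
      (τ (ℋ.r η)).map ofZop + (β (ℋ.r η)).map ofH
    obtain ⟨hk1, hk2⟩ := aemeasurable_add_measure_iff.1 hk
    -- As in the case of `γ`, one base point `y` and its translate by `η` share the parametrizing
    -- measure `lam`.
    obtain ⟨y, hy⟩ := hQ.surjective_r (ℋ.s η)
    have hy' : E.s y.unop = ℋ.r (ℋ.inv η) := Eq.trans hy (hℋ.r_inv η).symm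
    have hr : (E.op 𝒢 ℋ).s ((E.op 𝒢 ℋ).lact η y) = (E.op 𝒢 ℋ).s y := hE.r_ract hy'
    have hs : (E.op 𝒢 ℋ).r ((E.op 𝒢 ℋ).lact η y) = ℋ.r η :=
      (hE.right.s_ract _ _ hy').trans (hℋ.s_inv η)
    have h1 := aτ ((E.op 𝒢 ℋ).lact η y)
    have h2 := eτ ((E.op 𝒢 ℋ).lact η y)
    rw [hr] at h1 h2
    rw [hs] at h2
    rw [AEMeasurable.map_add₀ hk1 hk2]
    congr 1
    · refine map_map_of_parametrization mZop mZop hk1 (aτ y) h1 (by rw [← hy, eτ]) h2 ?_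
      filter_upwards [hlam.ae_r_eq h𝒢 ((E.op 𝒢 ℋ).s y)] with γ hγ
      refine congrArg ofZop (congrArg MulOpposite.op (hE.commute _ _ _ ?_ hy'))
      exact (h𝒢.s_inv γ).trans hγ.symm
    · refine map_map_of_parametrization mH mH hk2 aemeasurable_id (hβ.aemeasurable_mul hℋ η)
        Measure.map_id.symm (hβ.map_mul hℋ η).symm (ae_of_all _ fun δ => rfl)

variable [SecondCountableTopology G] [SecondCountableTopology H]

theorem IsEquivalence.support_linkingMeasure (hE : IsEquivalence 𝒢 ℋ E)
    (h𝒢 : 𝒢.IsLocallyCompactGroupoid) (hℋ : ℋ.IsLocallyCompactGroupoid)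
    (hlam : 𝒢.IsHaarSystem lam) (hβ : ℋ.IsHaarSystem β) (hσ : IsOrbitSystem E β σ)
    (hτ : IsOrbitSystem (E.op 𝒢 ℋ) lam τ) (w : G₀ ⊕ H₀) :
    (linkingMeasure lam β σ τ w).support = {l | (linking 𝒢 ℋ E).r l = w} := by
  have := h𝒢.t2_unitSpace
  have := hℋ.t2_unitSpace
  rcases w with u | v
  · rw [linkingMeasure, Measure.support_add, support_map_of_isClosedEmbedding
      isClosedEmbedding_ofG, support_map_of_isClosedEmbedding isClosedEmbedding_ofZ,
      hlam.support_eq, (hE.rightPrincipal hℋ.toIsGroupoid).support_orbitSystem hℋ hβ hσ]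
    ext ((x | x) | (x | x)) <;> simp [linking]
  · rw [linkingMeasure, Measure.support_add, support_map_of_isClosedEmbedding
      isClosedEmbedding_ofZop, support_map_of_isClosedEmbedding isClosedEmbedding_ofH,
      hβ.support_eq, (hE.rightPrincipal_op h𝒢).support_orbitSystem h𝒢 hlam hτ]
    ext ((x | x) | (x | x)) <;> simp [linking]

variable [T2Space G] [T2Space H] [LocallyCompactSpace G] [LocallyCompactSpace H]

theorem IsEquivalence.isHaarSystem_linkingMeasure (hE : IsEquivalence 𝒢 ℋ E)
    (h𝒢 : 𝒢.IsLocallyCompactGroupoid) (hℋ : ℋ.IsLocallyCompactGroupoid)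
    (hlam : 𝒢.IsHaarSystem lam) (hβ : ℋ.IsHaarSystem β) (hσ : IsOrbitSystem E β σ)
    (hτ : IsOrbitSystem (E.op 𝒢 ℋ) lam τ) :
    (linking 𝒢 ℋ E).IsHaarSystem (linkingMeasure lam β σ τ) := by
  have hκ := isLinkingSystem_linkingMeasure hlam.regular hβ.regular (fun u => (hσ u).1)
    (fun v => (hτ v).1)
  have hL := hE.linking_isLocallyCompactGroupoid h𝒢 hℋ
  have hsupp := hE.support_linkingMeasure h𝒢 hℋ hlam hβ hσ hτ
  refine ⟨hκ.regular, hsupp, fun F => continuous_sum_dom.2 ⟨?_, ?_⟩, fun F k => ?_⟩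
  · simp only [Function.comp_def, hκ.integral_inl]
    exact (hlam.continuous_integral (compClosedEmbedding F isClosedEmbedding_ofG)).add
      ((hE.rightPrincipal hℋ.toIsGroupoid).continuous_integral_orbitSystem hℋ hβ hσ
        (compClosedEmbedding F isClosedEmbedding_ofZ))
  · simp only [Function.comp_def, hκ.integral_inr]
    exact ((hE.rightPrincipal_op h𝒢).continuous_integral_orbitSystem h𝒢 hlam hτ
      (compClosedEmbedding F isClosedEmbedding_ofZop)).add
      (hβ.continuous_integral (compClosedEmbedding F isClosedEmbedding_ofH))
  -- Knowing the support first shows that `κ (s k)` lives on the elements composable with `k`, where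
  -- multiplication by `k` is continuous.
  · have hk := aemeasurable_of_continuousOn (hL.isClosed_rFiber _) (hL.ae_r_eq (hsupp _))
      (hL.continuousOn_mul_left k)
    rw [← hE.map_linkingMul_linkingMeasure h𝒢 hℋ hlam hβ hσ hτ hk]
    exact (integral_map_compactlySupported hk F).symm

end Linking

end GroupoidEquiv

end

theorem lemma3 {G₀ G H₀ H Z : Type*}
    [TopologicalSpace G₀] [TopologicalSpace G] [TopologicalSpace H₀] [TopologicalSpace H]
    [TopologicalSpace Z]
    [MeasurableSpace G] [BorelSpace G] [MeasurableSpace H] [BorelSpace H]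
    [MeasurableSpace Z] [BorelSpace Z]
    (𝒢 : GroupoidEquiv.GroupoidStr G₀ G) (h𝒢 : 𝒢.IsLocallyCompactGroupoid)
    (ℋ : GroupoidEquiv.GroupoidStr H₀ H) (hℋ : ℋ.IsLocallyCompactGroupoid)
    (lam : G₀ → Measure G) (hlam : 𝒢.IsHaarSystem lam)
    (β : H₀ → Measure H) (hβ : ℋ.IsHaarSystem β)
    (E : GroupoidEquiv.BiactionStr G₀ G H₀ H Z) (hE : GroupoidEquiv.IsEquivalence 𝒢 ℋ E) :
    -- `L` is a second countable locally compact Hausdorff groupoid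
    (GroupoidEquiv.linking 𝒢 ℋ E).IsLocallyCompactGroupoid ∧
    -- the families of orbit measures on `Z` and on `Z^op` exist and are unique
    (∃! σ : G₀ → Measure Z, GroupoidEquiv.IsOrbitSystem E β σ) ∧
    (∃! τ : H₀ → Measure Zᵐᵒᵖ, GroupoidEquiv.IsOrbitSystem (E.op 𝒢 ℋ) lam τ) ∧
    -- the family of measures on `L` built from them exists, is unique, and is a Haar system
    ∀ (σ : G₀ → Measure Z) (τ : H₀ → Measure Zᵐᵒᵖ),
      GroupoidEquiv.IsOrbitSystem E β σ → GroupoidEquiv.IsOrbitSystem (E.op 𝒢 ℋ) lam τ →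
      ∃ κ : G₀ ⊕ H₀ → Measure (GroupoidEquiv.LinkingSpace G Z H),
        GroupoidEquiv.IsLinkingSystem lam β σ τ κ ∧
        (∀ κ', GroupoidEquiv.IsLinkingSystem lam β σ τ κ' → κ' = κ) ∧
        (GroupoidEquiv.linking 𝒢 ℋ E).IsHaarSystem κ := by 
  have := h𝒢.t2
  have := h𝒢.locallyCompact
  have := h𝒢.secondCountable
  have := hℋ.t2
  have := hℋ.locallyCompact
  have := hℋ.secondCountable
  have := hE.t2
  have := hE.locallyCompact
  have := hE.secondCountable
  refine ⟨hE.linking_isLocallyCompactGroupoid h𝒢 hℋ,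
    (hE.rightPrincipal hℋ.toIsGroupoid).existsUnique_orbitSystem hℋ hβ,
    (hE.rightPrincipal_op h𝒢).existsUnique_orbitSystem h𝒢 hlam, fun σ τ hσ hτ => ?_⟩
  have hκ := GroupoidEquiv.isLinkingSystem_linkingMeasure hlam.regular hβ.regular
    (fun u => (hσ u).1) (fun v => (hτ v).1)
  exact ⟨_, hκ, fun κ' hκ' => hκ.unique hκ',
    hE.isHaarSystem_linkingMeasure h𝒢 hℋ hlam hβ hσ hτ⟩
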